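/- Let $F$ be a field of characteristic $0$, let $H$ be an associative unital $F$-algebra, and let $L$ be a finite dimensional semisimple Lie algebra over $F$ with a generalized $H$-action, that is, a homomorphism of unital algebras $\rho\colon H\to \operatorname{End}_F(L)$ (write $ha=\rho(h)a$) such that for every $h\in H$ there are $h'_1,h''_1,\dots,h'_k,h''_k\in H$ with $h[a,b]=\sum_{i=1}^k[h'_ia,h''_ib]$ for all $a,b\in L$. Let $L(X\mid H)$ be the free Lie algebra on the symbols $x_j^{\gamma}$, where $j$ runs over the natural numbers and $\gamma$ over a basis of $H$; for $h=\sum_\gamma\alpha_\gamma\gamma$ put $x_j^h=\sum_\gamma\alpha_\gamma x_j^\gamma$. Let $\operatorname{Id}^H(L)$ be the ideal of those $f\in L(X\mid H)$ that vanish under all substitutions $x_j^h\mapsto h\,l_j$ with $l_j\in L$, and let $c_n^H(L)$ be the dimension of the image in $L(X\mid H)/\operatorname{Id}^H(L)$ of the span of all Lie monomials in which each of $n$ fixed variables occurs exactly once (with any exponent in $H$) and no other variable occurs. The $H$-exponent of $L$ is $\exp^H(L)=\lim_{n\to\infty}\sqrt[n]{c_n^H(L)}$, if the limit exists. A Lie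 algebra with a generalized $H$-action is called $H$-simple if it is non-abelian and $0$ and itself are its only $H$-invariant ideals. Assume that $L$ is $H$-semisimple: $L=L_1\oplus\dots\oplus L_m$, where the $L_i$ are $H$-invariant ideals of $L$ that are $H$-simple. Then: 1. $\exp^H(L)$ exists and is an integer (the analog of Amitsur's conjecture). 2. If $F$ is algebraically closed, then $\exp^H(L)=\max_{1\le i\le m}\dim_F L_i$. 3. More generally, the formula in 2 holds over any field $F$ of characteristic $0$ if, for every $i$, the only $F$-linear maps $L_i\to L_i$ that commute with $\operatorname{ad}(L_i)$ and with the action of $H$ are the multiplications by scalars from $F$. (For $L=0$, i.e. $m=0$, the maximum is read as $0$.) -/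

import Mathlib

namespace HLie

section Actions

variable {F L H : Type*} [Field F] [LieRing L] [LieAlgebra F L] [Ring H] [Algebra F H]

/-- A homomorphism `ρ : H → End_F(L)` of unital algebras is a generalized action of `H` on the
Lie algebra `L` if for every `h` there are finitely many `h'ᵢ, h''ᵢ` in `H` with
`h [a, b] = ∑ᵢ [h'ᵢ a, h''ᵢ b]` for all `a, b`. -/
def IsGeneralizedAction (ρ : H →ₐ[F] Module.End F L) : Prop :=
  ∀ h : H, ∃ (k : ℕ) (h' h'' : Fin k → H), ∀ a b : L,
    ρ h ⁅a, b⁆ = ∑ i, ⁅ρ (h' i) a, ρ (h'' i) b⁆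

/-- An ideal `I` is `H`-invariant if `H I ⊆ I`. -/
def IsHInvariant (ρ : H →ₐ[F] Module.End F L) (I : LieIdeal F L) : Prop :=
  ∀ (h : H) (a : L), a ∈ I → ρ h a ∈ I

/-- `L` is `H`-simple: non-abelian, and `0` and `L` are the only `H`-invariant ideals. -/
def IsHSimple (ρ : H →ₐ[F] Module.End F L) : Prop :=
  ¬ IsLieAbelian L ∧ ∀ I : LieIdeal F L, IsHInvariant ρ I → I = ⊥ ∨ I = ⊤

/-- Every linear endomorphism of `L` that commutes with the adjoint action of `L` and with the
action of `H` is multiplication by a scalar of `F`. -/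
def IsHCentral (ρ : H →ₐ[F] Module.End F L) : Prop :=
  ∀ T : Module.End F L, (∀ a b : L, T ⁅a, b⁆ = ⁅a, T b⁆) →
    (∀ (h : H) (a : L), T (ρ h a) = ρ h (T a)) →
    ∃ c : F, ∀ a : L, T a = c • a

/-- The action of `H` on an `H`-invariant ideal. -/
def restrictAction (ρ : H →ₐ[F] Module.End F L) (I : LieIdeal F L) (hI : IsHInvariant ρ I) :
    H →ₐ[F] Module.End F I :=
  AlgHom.ofLinearMap
    { toFun := fun h =>
        { toFun := fun a => ⟨ρ h a, hI h a a.2⟩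
          map_add' := fun a b => Subtype.ext (by simp)
          map_smul' := fun c a => Subtype.ext (by simp) }
      map_add' := fun h k => LinearMap.ext fun a => Subtype.ext (by simp)
      map_smul' := fun c h => LinearMap.ext fun a => Subtype.ext (by simp) }
    (LinearMap.ext fun a => Subtype.ext (by simp))
    (fun h k => LinearMap.ext fun a => Subtype.ext (by simp))

end Actions

section Polynomials

variable (F H : Type*) [Field F] [Ring H] [Algebra F H]

/-- The algebra `L(X | H)` of Lie `H`-polynomials in the variables `x₀, x₁, …`: the free Lie
algebra on the symbols `xᵢ^γ`, where `γ` runs over a fixed basis of `H`. -/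
abbrev HPoly : Type _ := FreeLieAlgebra F (ℕ × Module.Basis.ofVectorSpaceIndex F H)

variable {H}

/-- The element `xᵢ^h` for arbitrary `h` in `H`, by linear extension from the basis. -/
noncomputable def hvar (i : ℕ) (h : H) : HPoly F H :=
  Finsupp.linearCombination F
    (fun γ : Module.Basis.ofVectorSpaceIndex F H => FreeLieAlgebra.of F (i, γ))
    ((Module.Basis.ofVectorSpace F H).repr h)

/-- `f` is a multilinear Lie monomial in the variables `xᵢ`, `i ∈ s`: a bracket of elements
`xᵢ^h` (in any order and arrangement) in which every `i ∈ s` occurs exactly once. -/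
inductive IsMultilinearMonomial : Finset ℕ → HPoly F H → Prop
  | hvar (i : ℕ) (h : H) : IsMultilinearMonomial {i} (hvar F i h)
  | lie {s t : Finset ℕ} {f g : HPoly F H} (hst : Disjoint s t)
      (hf : IsMultilinearMonomial s f) (hg : IsMultilinearMonomial t g) :
      IsMultilinearMonomial (s ∪ t) ⁅f, g⁆

variable (H)

/-- The space `V_n^H` of multilinear Lie `H`-polynomials in the `n` variables `x₀, …, xₙ₋₁`. -/
noncomputable def multilinearPart (n : ℕ) : Submodule F (HPoly F H) :=
  Submodule.span F {f | IsMultilinearMonomial F (Finset.range n) f}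

variable {F H} {L : Type*} [LieRing L] [LieAlgebra F L]

/-- Evaluation of `H`-polynomials under the substitution `xᵢ ↦ φ i`, `xᵢ^γ ↦ γ (φ i)`. -/
noncomputable def evalAt (ρ : H →ₐ[F] Module.End F L) (φ : ℕ → L) : HPoly F H →ₗ⁅F⁆ L :=
  FreeLieAlgebra.lift F fun p => ρ (Module.Basis.ofVectorSpace F H p.2) (φ p.1)

theorem evalAt_hvar (ρ : H →ₐ[F] Module.End F L) (φ : ℕ → L) (i : ℕ) (h : H) :
    evalAt ρ φ (hvar F i h) = ρ h (φ i) := by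
  have key : (evalAt ρ φ : HPoly F H →ₗ[F] L) ∘ₗ
      (Finsupp.linearCombination F
        (fun γ : Module.Basis.ofVectorSpaceIndex F H => FreeLieAlgebra.of F (i, γ))) ∘ₗ
      ((Module.Basis.ofVectorSpace F H).repr : H →ₗ[F] _) =
      (LinearMap.applyₗ (φ i)) ∘ₗ ρ.toLinearMap := by
    refine (Module.Basis.ofVectorSpace F H).ext fun γ => ?_
    simp [evalAt, -Module.Basis.coe_ofVectorSpace]
  exact LinearMap.congr_fun key h

/-- The ideal `Id^H(L)` of `H`-identities of `L`: the `H`-polynomials that vanish under all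
substitutions of elements of `L`. -/
noncomputable def hIdentities (ρ : H →ₐ[F] Module.End F L) : LieIdeal F (HPoly F H) :=
  ⨅ φ : ℕ → L, (evalAt ρ φ).ker

/-- The codimension `c_n^H(L)`: the dimension of the image of `V_n^H` in the relatively free
algebra `L(X | H) / Id^H(L)`. -/
noncomputable def hCodim (ρ : H →ₐ[F] Module.End F L) (n : ℕ) : ℕ :=
  Module.finrank F ((multilinearPart F H n).map (hIdentities ρ).toSubmodule.mkQ)

/-- The `H`-exponent `lim (c_n^H(L))^(1/n)` of `L` exists and equals `d`. -/
def HasHExponent (ρ : H →ₐ[F] Module.End F L) (d : ℝ) : Prop :=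
  Filter.Tendsto (fun n : ℕ => (hCodim ρ n : ℝ) ^ (1 / (n : ℝ))) Filter.atTop (nhds d)

end Polynomials

end HLie

/-!
Evaluation identifies the codimension `c_n` with the dimension of the space of functions on `L ^ n`
given by multilinear `H`-polynomials. Over direct sums of invariant ideals these functions split,
so `c_n` lies between the largest and the sum of the codimensions of the summands, and `L` may be
taken `H`-simple. Its centroid `K` is then a field, the functions are `K`-multilinear, and their
values at the tuples of vectors of a `K`-basis give `c_n ≤ C * d ^ n` with `d = dim_K L`.

For the lower bound, by Jacobson density every `K`-linear operator on `L` lies in the algebra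
generated by the brackets and the action of `H`. Hence a single polynomial, alternated in `d`
variables, takes the form `det φ • g` with `g` nonzero, and a trick of Razmyslov based on the
Killing form multiplies it by arbitrarily many further determinants. The products of determinants
attached to distinct words in `d` letters are linearly independent, because the rearrangement
inequality makes the matrix of their values at tuples of basis vectors triangular. For fixed `m`
there are about as many of them as a power of the multinomial coefficient of `m * d` into `d` equal
parts, which for large `m` exceeds `x ^ (m * d)` for any given `x < d`.
-/

namespace HLie

open Finset Function Module Filter Topology

section PolynomialFunctions

variable {F L H X Y : Type*} [Field F] [LieRing L] [LieAlgebra F L] [Ring H] [Algebra F H]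
  [DecidableEq X] [DecidableEq Y]

/-- The functions `(X → L) → L` given by the Lie monomials in which every variable from `s` occurs
exactly once, with some exponent in `H`, and no other variable occurs. The variables come from an
arbitrary type, so that they can be renamed and grouped into blocks. -/
inductive IsMonomialFun (ρ : H →ₐ[F] Module.End F L) : Finset X → ((X → L) → L) → Prop
  | var (i : X) (h : H) : IsMonomialFun ρ {i} fun φ => ρ h (φ i)
  | lie {s t : Finset X} {f g : (X → L) → L} (hst : Disjoint s t)
      (hf : IsMonomialFun ρ s f) (hg : IsMonomialFun ρ t g) :
      IsMonomialFun ρ (s ∪ t) fun φ => ⁅f φ, g φ⁆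

namespace IsMonomialFun

variable {ρ : H →ₐ[F] Module.End F L} {s : Finset X} {f : (X → L) → L}

theorem congr (hf : IsMonomialFun ρ s f) {φ ψ : X → L} (h : ∀ i ∈ s, φ i = ψ i) : f φ = f ψ := by
  induction hf with
  | var i _ => simp only [h i (mem_singleton_self i)]
  | lie _ _ _ ihf ihg =>
    simp only [ihf fun i hi => h i (mem_union_left _ hi),
      ihg fun i hi => h i (mem_union_right _ hi)]

theorem update_of_notMem (hf : IsMonomialFun ρ s f) {i : X} (hi : i ∉ s) (φ : X → L) (a : L) :
    f (update φ i a) = f φ :=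
  hf.congr fun _ hj => Function.update_of_ne (ne_of_mem_of_not_mem hj hi) _ _

theorem rename (hf : IsMonomialFun ρ s f) (σ : X ↪ Y) :
    IsMonomialFun ρ (s.map σ) fun φ => f (φ ∘ σ) := by
  induction hf with
  | var i h => simpa only [map_singleton] using! IsMonomialFun.var (ρ := ρ) (σ i) h
  | lie hst _ _ ihf ihg =>
    rw [map_union]
    exact .lie ((Finset.disjoint_map σ).2 hst) ihf ihg

theorem exists_rename {t : Finset Y} {g : (Y → L) → L} (hg : IsMonomialFun ρ t g) (σ : X ↪ Y)
    (hs : s.map σ = t) : ∃ f, IsMonomialFun ρ s f ∧ (fun φ => f (φ ∘ σ)) = g := by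
  induction hg generalizing s with
  | var j h =>
    obtain ⟨i, -, rfl⟩ := mem_map.1 (hs ▸ mem_singleton_self j)
    obtain rfl : s = {i} := map_injective σ (by rw [hs, map_singleton])
    exact ⟨_, .var i h, rfl⟩
  | @lie t₁ t₂ _ _ ht _ _ ih₁ ih₂ =>
    obtain ⟨s₁, -, rfl⟩ := subset_map_iff.1 (hs ▸ subset_union_left : t₁ ⊆ s.map σ)
    obtain ⟨s₂, -, rfl⟩ := subset_map_iff.1 (hs ▸ subset_union_right : t₂ ⊆ s.map σ)
    obtain ⟨f₁, hf₁, rfl⟩ := ih₁ rfl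
    obtain ⟨f₂, hf₂, rfl⟩ := ih₂ rfl
    obtain rfl : s = s₁ ∪ s₂ := map_injective σ (by rw [hs, map_union])
    exact ⟨_, .lie ((Finset.disjoint_map σ).1 ht) hf₁ hf₂, rfl⟩

end IsMonomialFun

variable (K : Type*) [Field K] [LieAlgebra K L]

/-- The `K`-span of the functions given by the multilinear Lie `H`-monomials in the variables `s`.
The field `K` is the ground field or the centroid of the algebra. -/
def polyFun (ρ : H →ₐ[F] Module.End F L) (s : Finset X) : Submodule K ((X → L) → L) :=
  Submodule.span K {f | IsMonomialFun ρ s f}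

/-- The action `ρ`, defined over `F`, is by endomorphisms that are linear over `K` as well. -/
def IsLinearOver (ρ : H →ₐ[F] Module.End F L) : Prop :=
  ∀ (h : H) (c : K) (a : L), ρ h (c • a) = c • ρ h a

variable {K} {ρ : H →ₐ[F] Module.End F L} {s t : Finset X} {f g : (X → L) → L}

theorem IsMonomialFun.mem_polyFun (hf : IsMonomialFun ρ s f) : f ∈ polyFun K ρ s :=
  Submodule.subset_span hf

theorem var_mem_polyFun (ρ : H →ₐ[F] Module.End F L) (i : X) :
    (fun φ => φ i) ∈ polyFun K ρ {i} := by
  simpa only [map_one] using! (IsMonomialFun.var (ρ := ρ) i 1).mem_polyFun (K := K)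

theorem lie_mem_polyFun (hst : Disjoint s t) (hf : f ∈ polyFun K ρ s) (hg : g ∈ polyFun K ρ t) :
    (fun φ => ⁅f φ, g φ⁆) ∈ polyFun K ρ (s ∪ t) := by
  induction hf, hg using Submodule.span_induction₂ with
  | mem_mem f g hf hg => exact (IsMonomialFun.lie hst hf hg).mem_polyFun
  | zero_left g hg => simp only [Pi.zero_apply, zero_lie]; exact zero_mem _
  | zero_right f hf => simp only [Pi.zero_apply, lie_zero]; exact zero_mem _
  | add_left f f' g _ _ _ h h' => simpa only [Pi.add_apply, add_lie] using! add_mem h h'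
  | add_right f g g' _ _ _ h h' => simpa only [Pi.add_apply, lie_add] using! add_mem h h'
  | smul_left c f g _ _ h =>
    simpa only [Pi.smul_apply, smul_lie] using! Submodule.smul_mem _ c h
  | smul_right c f g _ _ h =>
    simpa only [Pi.smul_apply, lie_smul] using! Submodule.smul_mem _ c h

theorem action_mem_polyFun (hρ : IsGeneralizedAction ρ) (hK : IsLinearOver K ρ) (h : H)
    (hf : f ∈ polyFun K ρ s) : (fun φ => ρ h (f φ)) ∈ polyFun K ρ s := by
  induction hf using Submodule.span_induction with
  | mem f hf =>
    simp only [Set.mem_ofPred_eq] at hf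
    induction hf generalizing h with
    | var i h' =>
      simpa only [map_mul] using! (IsMonomialFun.var (ρ := ρ) i (h * h')).mem_polyFun (K := K)
    | @lie s t f g hst _ _ ihf ihg =>
      obtain ⟨k, h', h'', hk⟩ := hρ h
      have expand : (fun φ => ρ h ⁅f φ, g φ⁆) =
          ∑ i, fun φ => ⁅ρ (h' i) (f φ), ρ (h'' i) (g φ)⁆ := by
        ext φ
        simp only [hk, Finset.sum_apply]
      rw [expand]
      exact sum_mem fun i _ => lie_mem_polyFun hst (ihf _) (ihg _)
  | zero => simp only [Pi.zero_apply, map_zero]; exact zero_mem _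
  | add f g _ _ hf hg => simpa only [Pi.add_apply, map_add] using! add_mem hf hg
  | smul c f _ hf => simpa only [Pi.smul_apply, hK h c] using! Submodule.smul_mem _ c hf

theorem map_funLeft_polyFun (ρ : H →ₐ[F] Module.End F L) (σ : X ↪ Y) (s : Finset X) :
    (polyFun K ρ s).map (LinearMap.funLeft K L fun φ : Y → L => φ ∘ σ) =
      polyFun K ρ (s.map σ) := by
  rw [polyFun, Submodule.map_span, polyFun]
  congr 1
  ext g
  constructor
  · rintro ⟨f, hf, rfl⟩
    exact hf.rename σ
  · intro hg
    exact hg.exists_rename σ rfl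

theorem rename_mem_polyFun (hf : f ∈ polyFun K ρ s) (σ : X ↪ Y) :
    (fun φ => f (φ ∘ σ)) ∈ polyFun K ρ (s.map σ) :=
  map_funLeft_polyFun (K := K) ρ σ s ▸ Submodule.mem_map_of_mem hf

theorem rename_equiv_mem_polyFun [Fintype X] [Fintype Y] (hf : f ∈ polyFun K ρ univ) (σ : X ≃ Y) :
    (fun φ => f (φ ∘ σ)) ∈ polyFun K ρ univ := by
  simpa only [univ_map_equiv_to_embedding] using! rename_mem_polyFun hf σ.toEmbedding

theorem subst_mem_polyFun (hρ : IsGeneralizedAction ρ) (hK : IsLinearOver K ρ) {i : X}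
    (hi : i ∈ s) (hst : Disjoint (s.erase i) t) (hf : f ∈ polyFun K ρ s) (hg : g ∈ polyFun K ρ t) :
    (fun φ => f (update φ i (g φ))) ∈ polyFun K ρ (s.erase i ∪ t) := by
  induction hf using Submodule.span_induction with
  | mem f hf =>
    simp only [Set.mem_ofPred_eq] at hf
    induction hf with
    | var j h =>
      obtain rfl : i = j := by simpa using hi
      simpa using action_mem_polyFun hρ hK h hg
    | @lie u v f₁ f₂ huv hf₁ hf₂ ih₁ ih₂ =>
      rcases mem_union.1 hi with hu | hv
      · have hv : i ∉ v := Finset.disjoint_left.1 huv hu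
        rw [erase_union_distrib, erase_eq_of_notMem hv] at hst ⊢
        rw [disjoint_union_left] at hst
        have disj : Disjoint (u.erase i ∪ t) v :=
          disjoint_union_left.2 ⟨huv.mono_left (erase_subset _ _), hst.2.symm⟩
        simpa only [hf₂.update_of_notMem hv, union_right_comm] using
          lie_mem_polyFun (K := K) disj (ih₁ hu hst.1) hf₂.mem_polyFun
      · have hu : i ∉ u := Finset.disjoint_right.1 huv hv
        rw [erase_union_distrib, erase_eq_of_notMem hu] at hst ⊢
        rw [disjoint_union_left] at hst
        have disj : Disjoint u (v.erase i ∪ t) :=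
          disjoint_union_right.2 ⟨huv.mono_right (erase_subset _ _), hst.1⟩
        simpa only [hf₁.update_of_notMem hu, union_assoc] using
          lie_mem_polyFun (K := K) disj hf₁.mem_polyFun (ih₂ hv hst.2)
  | zero => exact (polyFun K ρ _).zero_mem
  | add f g _ _ hf hg => exact add_mem hf hg
  | smul c f _ hf => exact Submodule.smul_mem _ c hf

theorem isLinearMap_of_mem_polyFun (hK : IsLinearOver K ρ) {i : X} (hi : i ∈ s)
    (hf : f ∈ polyFun K ρ s) (φ : X → L) : IsLinearMap K fun a => f (update φ i a) := by
  induction hf using Submodule.span_induction with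
  | mem f hf =>
    simp only [Set.mem_ofPred_eq] at hf
    induction hf with
    | var j h =>
      obtain rfl : i = j := by simpa using hi
      exact ⟨by simp, by simp [hK h]⟩
    | @lie u v f₁ f₂ huv hf₁ hf₂ ih₁ ih₂ =>
      rcases mem_union.1 hi with hu | hv
      · have hv : i ∉ v := Finset.disjoint_left.1 huv hu
        exact ⟨fun a b => by simp [hf₂.update_of_notMem hv, (ih₁ hu).map_add],
          fun c a => by simp [hf₂.update_of_notMem hv, (ih₁ hu).map_smul]⟩
      · have hu : i ∉ u := Finset.disjoint_right.1 huv hv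
        exact ⟨fun a b => by simp [hf₁.update_of_notMem hu, (ih₂ hv).map_add],
          fun c a => by simp [hf₁.update_of_notMem hu, (ih₂ hv).map_smul]⟩
  | zero => exact ⟨by simp, by simp⟩
  | add f g _ _ hf hg =>
    exact ⟨fun a b => by simp only [Pi.add_apply, hf.map_add, hg.map_add]; abel,
      fun c a => by simp [hf.map_smul, hg.map_smul]⟩
  | smul c f _ hf =>
    exact ⟨fun a b => by simp [hf.map_add], fun r a => by simp [hf.map_smul, smul_comm c r]⟩

/-- A function in `polyFun K ρ univ` as a multilinear map. -/
def toMultilinearMap [Fintype X] (hK : IsLinearOver K ρ) (hf : f ∈ polyFun K ρ univ) :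
    MultilinearMap K (fun _ : X => L) L :=
  .mk' f (fun φ i => (isLinearMap_of_mem_polyFun hK (mem_univ i) hf φ).map_add)
    (fun φ i => (isLinearMap_of_mem_polyFun hK (mem_univ i) hf φ).map_smul)

end PolynomialFunctions

section Codimension

theorem card_le_finrank_of_mem_span {F K M J : Type*} [Field F] [Field K] [Algebra F K]
    [AddCommGroup M] [Module F M] [Module K M] [IsScalarTower F K M] [Fintype J]
    {V : Submodule F M} [FiniteDimensional F V] {f : J → M} (hf : LinearIndependent K f)
    (hmem : ∀ j, f j ∈ Submodule.span K (V : Set M)) : Fintype.card J ≤ finrank F V := by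
  let B := finBasis F V
  have spans : Submodule.span K (Set.range fun i => (B i : M)) = Submodule.span K (V : Set M) := by
    rw [← Submodule.span_span_of_tower F K, Set.range_comp' Subtype.val B,
      ← Submodule.coe_subtype V, Submodule.span_image, B.span_eq, Submodule.map_subtype_top]
  have := FiniteDimensional.span_of_finite K (Set.finite_range fun i => (B i : M))
  have restricted : LinearIndependent K fun j =>
      (⟨f j, spans ▸ hmem j⟩ : Submodule.span K (Set.range fun i => (B i : M))) :=
    .of_comp (Submodule.subtype _) hf
  calc Fintype.card J ≤ finrank K (Submodule.span K (Set.range fun i => (B i : M))) :=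
        restricted.fintype_card_le_finrank
    _ ≤ finrank F V := (finrank_range_le_card _).trans_eq (Fintype.card_fin _)

variable {F L H : Type*} [Field F] [LieRing L] [LieAlgebra F L] [Ring H] [Algebra F H]

theorem IsMultilinearMonomial.isMonomialFun (ρ : H →ₐ[F] Module.End F L) {s : Finset ℕ}
    {f : HPoly F H} (hf : IsMultilinearMonomial F s f) :
    IsMonomialFun ρ s fun φ => evalAt ρ φ f := by
  induction hf with
  | hvar i h => simpa only [evalAt_hvar] using IsMonomialFun.var (ρ := ρ) i h
  | lie hst _ _ ihf ihg => simpa only [LieHom.map_lie] using IsMonomialFun.lie hst ihf ihg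

theorem IsMonomialFun.exists_monomial {ρ : H →ₐ[F] Module.End F L} {s : Finset ℕ}
    {g : (ℕ → L) → L} (hg : IsMonomialFun ρ s g) :
    ∃ f : HPoly F H, IsMultilinearMonomial F s f ∧ (fun φ => evalAt ρ φ f) = g := by
  induction hg with
  | var i h => exact ⟨_, .hvar i h, by simp only [evalAt_hvar]⟩
  | lie hst _ _ ihf ihg =>
    obtain ⟨f, hf, rfl⟩ := ihf
    obtain ⟨g, hg, rfl⟩ := ihg
    exact ⟨_, .lie hst hf hg, by simp only [LieHom.map_lie]⟩

theorem mem_hIdentities {ρ : H →ₐ[F] Module.End F L} {f : HPoly F H} :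
    f ∈ hIdentities ρ ↔ ∀ φ, evalAt ρ φ f = 0 := by
  simp only [hIdentities, LieSubmodule.mem_iInf, LieHom.mem_ker]

/-- Evaluation of `H`-polynomials as a linear map to functions on substitutions. -/
noncomputable def evalLinear (ρ : H →ₐ[F] Module.End F L) : HPoly F H →ₗ[F] ((ℕ → L) → L) :=
  LinearMap.pi fun φ => (evalAt ρ φ : HPoly F H →ₗ[F] L)

theorem ker_evalLinear (ρ : H →ₐ[F] Module.End F L) :
    LinearMap.ker (evalLinear ρ) = (hIdentities ρ).toSubmodule := by
  ext f
  simp only [LinearMap.mem_ker, LieSubmodule.mem_toSubmodule, mem_hIdentities, funext_iff]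
  rfl

theorem map_evalLinear_multilinearPart (ρ : H →ₐ[F] Module.End F L) (n : ℕ) :
    (multilinearPart F H n).map (evalLinear ρ) = polyFun F ρ (range n) := by
  rw [multilinearPart, Submodule.map_span, polyFun]
  congr 1
  ext g
  constructor
  · rintro ⟨f, hf, rfl⟩
    exact hf.isMonomialFun ρ
  · exact fun hg => hg.exists_monomial

/-- The image of `V_n^H` in the relatively free algebra, as the space of multilinear functions in
variables indexed by a type `X` with `n` elements. -/
noncomputable def multilinearPartEquiv (ρ : H →ₐ[F] Module.End F L) (X : Type*) [Fintype X]
    [DecidableEq X] :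
    (multilinearPart F H (Fintype.card X)).map (hIdentities ρ).toSubmodule.mkQ ≃ₗ[F]
      polyFun F ρ (univ : Finset X) :=
  let σ : X ↪ ℕ := (Fintype.equivFin X).toEmbedding.trans Fin.valEmbedding
  have hσ : univ.map σ = range (Fintype.card X) := by
    rw [← Finset.map_map, univ_map_equiv_to_embedding, Fin.map_valEmbedding_univ, Nat.Iio_eq_range]
  have hmap : ((multilinearPart F H (Fintype.card X)).map (hIdentities ρ).toSubmodule.mkQ).map
      ((hIdentities ρ).toSubmodule.liftQ (evalLinear ρ) (ker_evalLinear ρ).ge) =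
        (polyFun F ρ univ).map (LinearMap.funLeft F L fun φ : ℕ → L => φ ∘ σ) := by
    rw [← Submodule.map_comp, Submodule.liftQ_mkQ, map_evalLinear_multilinearPart,
      map_funLeft_polyFun, hσ]
  (Submodule.equivMapOfInjective _ (LinearMap.ker_eq_bot.1 <| Submodule.ker_liftQ_eq_bot _ _ _
      (ker_evalLinear ρ).le) _).trans <|
    (LinearEquiv.ofEq _ _ hmap).trans <|
      (Submodule.equivMapOfInjective _
        (LinearMap.funLeft_injective_of_surjective _ _ _ σ.injective.surjective_comp_right) _).symm

theorem hCodim_card (ρ : H →ₐ[F] Module.End F L) (X : Type*) [Fintype X] [DecidableEq X] :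
    hCodim ρ (Fintype.card X) = finrank F (polyFun F ρ (univ : Finset X)) :=
  (multilinearPartEquiv ρ X).finrank_eq

theorem span_polyFun (K : Type*) [Field K] [LieAlgebra K L] [Algebra F K] [IsScalarTower F K L]
    {X : Type*} [DecidableEq X] (ρ : H →ₐ[F] Module.End F L) (s : Finset X) :
    Submodule.span K (polyFun F ρ s : Set ((X → L) → L)) = polyFun K ρ s :=
  Submodule.span_span_of_tower F K _

section Bounds

variable {K ι X : Type*} [Field K] [LieAlgebra K L] [Algebra F K] [IsScalarTower F K L]
  [Fintype X] [DecidableEq X] {ρ : H →ₐ[F] Module.End F L}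

/-- Evaluation of multilinear functions at all tuples of vectors of a basis. -/
noncomputable def evalBasis (ρ : H →ₐ[F] Module.End F L) (e : Basis ι K L) :
    polyFun F ρ (univ : Finset X) →ₗ[F] ((X → ι) → L) :=
  LinearMap.funLeft F L (fun w : X → ι => e ∘ w) ∘ₗ Submodule.subtype _

theorem evalBasis_injective (hK : IsLinearOver K ρ) (e : Basis ι K L) :
    Injective (evalBasis (X := X) ρ e) := by
  rw [injective_iff_map_eq_zero]
  intro f hf
  have hfK : f.1 ∈ polyFun K ρ univ := (span_polyFun K ρ univ).le (Submodule.subset_span f.2)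
  have vanish : toMultilinearMap hK hfK = 0 :=
    Basis.ext_multilinear (fun _ => e) fun w => congrFun hf w
  exact Subtype.ext (funext fun φ => congrArg (fun M => M φ) vanish)

variable [FiniteDimensional F L] [Fintype ι]

theorem finiteDimensional_polyFun (ρ : H →ₐ[F] Module.End F L) (X : Type*) [Fintype X]
    [DecidableEq X] : FiniteDimensional F (polyFun F ρ (univ : Finset X)) :=
  Module.Finite.of_injective _
    (evalBasis_injective (X := X) (fun h => map_smul (ρ h)) (Module.finBasis F L))

instance (ρ : H →ₐ[F] Module.End F L) (n : ℕ) :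
    FiniteDimensional F ((multilinearPart F H n).map (hIdentities ρ).toSubmodule.mkQ) := by
  have := finiteDimensional_polyFun ρ (Fin n)
  have := Module.Finite.equiv (multilinearPartEquiv ρ (Fin n)).symm
  rwa [Fintype.card_fin] at this

theorem hCodim_le (hK : IsLinearOver K ρ) (e : Basis ι K L) (n : ℕ) :
    hCodim ρ n ≤ finrank F L * Fintype.card ι ^ n := by
  have h := LinearMap.finrank_le_finrank_of_injective
    (evalBasis_injective (ρ := ρ) (X := Fin n) hK e)
  rwa [← hCodim_card, finrank_pi_fintype, sum_const, card_univ, Fintype.card_fun,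
    Fintype.card_fin, smul_eq_mul, mul_comm] at h

theorem card_le_hCodim {J : Type*} [Fintype J] {f : J → (X → L) → L} (hf : LinearIndependent K f)
    (hmem : ∀ j, f j ∈ polyFun K ρ univ) : Fintype.card J ≤ hCodim ρ (Fintype.card X) := by
  have := finiteDimensional_polyFun ρ X
  rw [hCodim_card]
  exact card_le_finrank_of_mem_span hf fun j => (span_polyFun K ρ univ).ge (hmem j)

end Bounds

end Codimension

section Determinants

variable {K V ι : Type*} [Field K] [AddCommGroup V] [Module K V] [Fintype ι] [DecidableEq ι]
  (e : Basis ι K V)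

/- With `A` and `B` the matrices of `T` and of `a`, Cramer's rule turns the `i`-th summand into the
`i`-th diagonal entry of `adj B * (A * B)`. -/
theorem sum_det_update_eq_trace_mul_det (T : V →ₗ[K] V) (a : ι → V) :
    ∑ i, e.det (update a i (T (a i))) = LinearMap.trace K V T * e.det a := by
  have cramer (i : ι) : e.det (update a i (T (a i))) =
      ((e.toMatrix a).adjugate * (LinearMap.toMatrix e e T * e.toMatrix a)) i i := by
    rw [Basis.det_apply, Basis.toMatrix_update, ← Matrix.cramer_apply,
      Matrix.cramer_eq_adjugate_mulVec, ← LinearMap.toMatrix_mulVec_repr e e T (a i)]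
    rfl
  calc ∑ i, e.det (update a i (T (a i)))
      = ((e.toMatrix a).adjugate * (LinearMap.toMatrix e e T * e.toMatrix a)).trace :=
        sum_congr rfl fun i _ => cramer i
    _ = LinearMap.trace K V T * e.det a := by
        rw [Matrix.trace_mul_comm, Matrix.mul_assoc, Matrix.mul_adjugate, Matrix.mul_smul,
          Matrix.mul_one, Matrix.trace_smul, smul_eq_mul, mul_comm,
          ← LinearMap.trace_eq_matrix_trace, Basis.det_apply]

theorem det_bilinForm_apply (B : LinearMap.BilinForm K V) (a b : ι → V) :
    (Matrix.of fun i j => B (a i) (b j)).det =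
      (LinearMap.BilinForm.toMatrix e B).det * (e.det a * e.det b) := by
  have factor : (Matrix.of fun i j => B (a i) (b j)) =
      (e.toMatrix a).transpose * LinearMap.BilinForm.toMatrix e B * e.toMatrix b := by
    ext i j
    rw [Matrix.of_apply, LinearMap.BilinForm.apply_eq_dotProduct_toMatrix_mulVec e,
      Matrix.mul_assoc]
    rfl
  rw [factor, Matrix.det_mul, Matrix.det_mul, Matrix.det_transpose, Basis.det_apply,
    Basis.det_apply]
  ring

theorem alternatingMap_apply_eq_det_smul {V' : Type*} [AddCommGroup V'] [Module K V']
    (f : V [⋀^ι]→ₗ[K] V') (a : ι → V) : f a = e.det a • f e := by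
  suffices f = (LinearMap.toSpanSingleton K V' (f e)).compAlternatingMap e.det from
    congrArg (fun g => g a) this
  refine e.ext_alternating fun v hv => ?_
  let σ : Equiv.Perm ι := .ofBijective v (Finite.injective_iff_bijective.1 hv)
  have hσ : (fun i => e (v i)) = e ∘ σ := rfl
  simp only [hσ, AlternatingMap.map_perm, LinearMap.compAlternatingMap_apply, Basis.det_self,
    LinearMap.toSpanSingleton_apply, one_smul]

end Determinants

section Cofactors

variable {F K L H ι X Y : Type*} [Field F] [LieRing L] [LieAlgebra F L] [Ring H] [Algebra F H]
  [Field K] [LieAlgebra K L] [Fintype ι] [DecidableEq ι] [DecidableEq X] [DecidableEq Y]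
  {ρ : H →ₐ[F] Module.End F L} {e : Basis ι K L}

/-- The function `g` of the variables in `t` becomes a multilinear `H`-polynomial when it is
multiplied by the determinant of a separate block of variables, indexed by `ι`. Razmyslov's trick
enlarges `g` while that block is kept. -/
def IsDetCofactor (ρ : H →ₐ[F] Module.End F L) (e : Basis ι K L) (t : Finset X)
    (g : (X → L) → L) : Prop :=
  (fun φ : ι ⊕ X → L => e.det (φ ∘ Sum.inl) • g (φ ∘ Sum.inr)) ∈ polyFun K ρ (univ.disjSum t)

namespace IsDetCofactor

variable {t : Finset X} {g : (X → L) → L}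

theorem rename (h : IsDetCofactor ρ e t g) (σ : X ↪ Y) :
    IsDetCofactor ρ e (t.map σ) fun φ => g (φ ∘ σ) := by
  have hset : (univ.disjSum t).map (Embedding.sumMap (.refl ι) σ) = univ.disjSum (t.map σ) := by
    ext (i | i) <;> simp
  rw [IsDetCofactor, ← hset]
  exact rename_mem_polyFun h (Embedding.sumMap (.refl ι) σ)

theorem smul (h : IsDetCofactor ρ e t g) (c : K) : IsDetCofactor ρ e t fun φ => c • g φ := by
  simpa only [IsDetCofactor, smul_comm _ c] using! Submodule.smul_mem _ c h

theorem sum {J : Type*} {S : Finset J} {g : J → (X → L) → L}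
    (h : ∀ j ∈ S, IsDetCofactor ρ e t (g j)) : IsDetCofactor ρ e t fun φ => ∑ j ∈ S, g j φ := by
  rw [IsDetCofactor]
  convert sum_mem h using 1
  ext φ
  simp only [smul_sum, Finset.sum_apply]

theorem lie (h : IsDetCofactor ρ e t g) {j : X} (hj : j ∉ t) :
    IsDetCofactor ρ e (insert j t) fun φ => ⁅φ j, g φ⁆ := by
  have hset : ({Sum.inr j} ∪ univ.disjSum t : Finset (ι ⊕ X)) = univ.disjSum (insert j t) := by
    ext (i | i) <;> simp
  simpa only [IsDetCofactor, lie_smul, hset] using! lie_mem_polyFun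
    (disjoint_singleton_left.2 (mt inr_mem_disjSum.1 hj)) (var_mem_polyFun ρ (Sum.inr j)) h

/- Razmyslov's trick: substituting `⁅u, ⁅v, x⁆⁆` for each variable `x` of the determinant in turn
and summing multiplies the determinant by the trace of `ad u ∘ ad v`. -/
theorem killingForm_smul (hρ : IsGeneralizedAction ρ) (hK : IsLinearOver K ρ)
    (h : IsDetCofactor ρ e t g) {u v : X} (hu : u ∉ t) (hv : v ∉ t) (huv : u ≠ v) :
    IsDetCofactor ρ e (insert u (insert v t)) fun φ => killingForm K L (φ u) (φ v) • g φ := by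
  let substituted (i : ι) (φ : ι ⊕ X → L) : ι ⊕ X → L :=
    update φ (Sum.inl i) ⁅φ (Sum.inr u), ⁅φ (Sum.inr v), φ (Sum.inl i)⁆⁆
  have summand_mem (i : ι) : (fun φ : ι ⊕ X → L =>
      e.det (substituted i φ ∘ Sum.inl) • g (substituted i φ ∘ Sum.inr)) ∈
        polyFun K ρ (univ.disjSum (insert u (insert v t))) := by
    have bracket_mem := lie_mem_polyFun (K := K) (s := {Sum.inr u})
      (t := {Sum.inr v} ∪ {Sum.inl i}) (by simp [huv]) (var_mem_polyFun ρ _)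
      (lie_mem_polyFun (by simp) (var_mem_polyFun ρ _) (var_mem_polyFun ρ _))
    have disj : Disjoint ((univ.disjSum t).erase (Sum.inl i))
        ({Sum.inr u} ∪ ({Sum.inr v} ∪ {Sum.inl i})) := by
      simp [hu, hv]
    have hset : (univ.disjSum t).erase (Sum.inl i) ∪ ({Sum.inr u} ∪ ({Sum.inr v} ∪ {Sum.inl i})) =
        univ.disjSum (insert u (insert v t)) := by
      ext (j | j)
      · simp
      · simp only [mem_union, mem_erase, inr_mem_disjSum, mem_singleton, mem_insert, ne_eq,
          reduceCtorEq, not_false_eq_true, Sum.inr.injEq]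
        tauto
    exact hset ▸ subst_mem_polyFun hρ hK (by simp) disj h bracket_mem
  rw [IsDetCofactor]
  convert sum_mem fun i (_ : i ∈ univ) => summand_mem i using 1
  ext φ
  have trace := sum_det_update_eq_trace_mul_det e
    (LieAlgebra.ad K L (φ (Sum.inr u)) ∘ₗ LieAlgebra.ad K L (φ (Sum.inr v))) (φ ∘ Sum.inl)
  simp only [LinearMap.comp_apply, LieAlgebra.ad_apply, comp_apply] at trace
  simp only [substituted, Finset.sum_apply, Sum.update_inl_comp_inl, Sum.update_inl_comp_inr,
    ← sum_smul, trace, killingForm_apply_apply, smul_smul, comp_apply]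
  rw [mul_comm]

theorem prod_killingForm_smul (hρ : IsGeneralizedAction ρ) (hK : IsLinearOver K ρ)
    (h : IsDetCofactor ρ e t g) {J : Type*} (w : J ⊕ J ↪ X) (hw : ∀ p, w p ∉ t)
    (S : Finset J) :
    IsDetCofactor ρ e ((S.disjSum S).map w ∪ t)
      fun φ => (∏ j ∈ S, killingForm K L (φ (w (.inl j))) (φ (w (.inr j)))) • g φ := by
  classical
  induction S using Finset.induction_on with
  | empty => simpa using h
  | @insert j S hj ih =>
    have hset : ((insert j S).disjSum (insert j S)).map w ∪ t =
        insert (w (.inl j)) (insert (w (.inr j)) ((S.disjSum S).map w ∪ t)) := by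
      have : (insert j S).disjSum (insert j S) =
          insert (Sum.inl j) (insert (Sum.inr j) (S.disjSum S)) := by
        ext (i | i) <;> simp
      simp only [this, map_insert, insert_union]
    simp only [prod_insert hj, mul_smul, hset]
    exact ih.killingForm_smul hρ hK (by simp [hj, hw]) (by simp [hj, hw]) (by simp)

variable [LieAlgebra.IsKilling K L]

/- Expanding the determinant of the matrix of all `κ(uᵢ, vⱼ)` shows that `det u * det v` is a linear
combination of products of values of the Killing form `κ`. -/
theorem det_mul_det_smul (hρ : IsGeneralizedAction ρ) (hK : IsLinearOver K ρ)
    (h : IsDetCofactor ρ e t g) (w : ι ⊕ ι ↪ X) (hw : ∀ p, w p ∉ t) :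
    IsDetCofactor ρ e (univ.map w ∪ t)
      fun φ => (e.det (φ ∘ w ∘ Sum.inl) * e.det (φ ∘ w ∘ Sum.inr)) • g φ := by
  have expansion_mem (σ : Equiv.Perm ι) : IsDetCofactor ρ e (univ.map w ∪ t) fun φ =>
      (∏ i, killingForm K L (φ (w (.inl i))) (φ (w (.inr (σ i))))) • g φ := by
    have hset : univ.map ((Equiv.sumCongr (.refl ι) σ).toEmbedding.trans w) = univ.map w := by
      rw [← Finset.map_map, univ_map_equiv_to_embedding]
    rw [← hset, ← univ_disjSum_univ]
    exact h.prod_killingForm_smul hρ hK ((Equiv.sumCongr (.refl ι) σ).toEmbedding.trans w)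
      (fun _ => hw _) univ
  have gram_ne_zero : (LinearMap.BilinForm.toMatrix e (killingForm K L)).det ≠ 0 :=
    (LinearMap.BilinForm.nondegenerate_iff_det_ne_zero e).1
      (LieAlgebra.IsKilling.killingForm_nondegenerate K L)
  convert (sum fun σ (_ : σ ∈ univ) => (expansion_mem σ).smul
    ((Equiv.Perm.sign σ : ℤˣ) : ℤ)).smul (LinearMap.BilinForm.toMatrix e (killingForm K L)).det⁻¹
    using 2 with φ
  have gram := det_bilinForm_apply e (killingForm K L) (φ ∘ w ∘ Sum.inl) (φ ∘ w ∘ Sum.inr)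
  rw [← Matrix.det_transpose, Matrix.det_apply'] at gram
  simp only [Matrix.transpose_apply, Matrix.of_apply, comp_apply] at gram
  simp only [smul_smul, ← sum_smul, gram, inv_mul_cancel_left₀ gram_ne_zero]

theorem prod_det_smul (hρ : IsGeneralizedAction ρ) (hK : IsLinearOver K ρ) [Fintype X]
    (h : IsDetCofactor ρ e univ g) {J : Type*} [DecidableEq J] {S : Finset J} (hS : Even S.card) :
    IsDetCofactor ρ e ((S ×ˢ (univ : Finset ι)).disjSum univ) fun φ : (J × ι) ⊕ X → L =>
      (∏ j ∈ S, e.det fun r => φ (Sum.inl (j, r))) • g (φ ∘ Sum.inr) := by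
  obtain ⟨k, hk⟩ := hS
  induction k generalizing S with
  | zero =>
    obtain rfl := card_eq_zero.1 hk
    simpa [← empty_disjSum] using! h.rename (Y := (J × ι) ⊕ X) .inr
  | succ k ih =>
    obtain ⟨a, S', ha, rfl, hS'⟩ := card_eq_succ.1 (hk.trans (by omega : _ = (k + k + 1) + 1))
    obtain ⟨b, S, hb, rfl, hS⟩ := card_eq_succ.1 hS'
    obtain ⟨hab, ha⟩ : a ≠ b ∧ a ∉ S := by simpa using ha
    let w : ι ⊕ ι ↪ (J × ι) ⊕ X :=
      ⟨Sum.elim (fun r => .inl (a, r)) (fun r => .inl (b, r)), by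
        rintro (i | i) (j | j) <;> simp [hab, hab.symm]⟩
    have w_inl (r : ι) : w (.inl r) = .inl (a, r) := rfl
    have w_inr (r : ι) : w (.inr r) = .inl (b, r) := rfl
    have hset : univ.map w ∪ (S ×ˢ univ).disjSum univ =
        (insert a (insert b S) ×ˢ (univ : Finset ι)).disjSum (univ : Finset X) := by
      ext (⟨j, i⟩ | i) <;> simp [w_inl, w_inr, eq_comm, or_assoc]
    have hw : ∀ p, w p ∉ (S ×ˢ univ).disjSum (univ : Finset X) := by
      rintro (i | i) <;> simp [w_inl, w_inr, ha, hb]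
    have extended := (ih hS).det_mul_det_smul hρ hK w hw
    rw [hset] at extended
    convert extended using 2 with φ
    rw [prod_insert (by simp [hab, ha]), prod_insert hb, ← mul_assoc, mul_smul]
    rfl

end IsDetCofactor

end Cofactors

section CofactorExistence

variable {F K L H X : Type*} [Field F] [LieRing L] [LieAlgebra F L] [Ring H] [Algebra F H]
  [Field K] [LieAlgebra K L] [DecidableEq X] {ρ : H →ₐ[F] Module.End F L}

/-- The algebra of operators on `L` generated by the adjoint action of `L` and the action
of `H`. -/
def multiplicationAlgebra (ρ : H →ₐ[F] Module.End F L) : Subalgebra F (Module.End F L) :=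
  Algebra.adjoin F (Set.range (LieAlgebra.ad F L) ∪ Set.range ρ)

variable (K) in
/-- Every `K`-linear operator on `L` lies in the multiplication algebra, as in Jacobson's density
theorem. -/
def IsDenseOver (ρ : H →ₐ[F] Module.End F L) : Prop :=
  ∀ T : Module.End K L, ∃ T' ∈ multiplicationAlgebra ρ, ∀ a, T' a = T a

variable (K) in
/-- The span of the functions obtained from multilinear `H`-polynomials in the variables `s` and
finitely many further variables by fixing the values of the latter. -/
def specializedFun (ρ : H →ₐ[F] Module.End F L) (s : Finset X) : Submodule K ((X → L) → L) :=
  Submodule.span K {p | ∃ (n : ℕ) (f : (X ⊕ Fin n → L) → L) (φ : Fin n → L),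
    f ∈ polyFun K ρ (s.disjSum univ) ∧ p = fun ψ => f (Sum.elim ψ φ)}

variable {s : Finset X} {p : (X → L) → L}

theorem const_mem_specializedFun (ρ : H →ₐ[F] Module.End F L) (a : L) :
    (fun _ => a) ∈ specializedFun (X := X) K ρ ∅ :=
  Submodule.subset_span ⟨1, fun φ => φ (Sum.inr 0), fun _ => a,
    by simpa [← empty_disjSum] using! var_mem_polyFun ρ (Sum.inr 0), rfl⟩

theorem action_mem_specializedFun (hρ : IsGeneralizedAction ρ) (hK : IsLinearOver K ρ) (h : H)
    (hp : p ∈ specializedFun K ρ s) : (fun ψ => ρ h (p ψ)) ∈ specializedFun K ρ s := by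
  induction hp using Submodule.span_induction with
  | mem p hp =>
    obtain ⟨n, f, φ, hf, rfl⟩ := hp
    exact Submodule.subset_span ⟨n, _, φ, action_mem_polyFun hρ hK h hf, rfl⟩
  | zero => simp only [Pi.zero_apply, map_zero]; exact zero_mem _
  | add f g _ _ hf hg => simpa only [Pi.add_apply, map_add] using! add_mem hf hg
  | smul c f _ hf => simpa only [Pi.smul_apply, hK h c] using! Submodule.smul_mem _ c hf

theorem lie_const_mem_specializedFun (a : L) (hp : p ∈ specializedFun K ρ s) :
    (fun ψ => ⁅a, p ψ⁆) ∈ specializedFun K ρ s := by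
  induction hp using Submodule.span_induction with
  | mem p hp =>
    obtain ⟨n, f, φ, hf, rfl⟩ := hp
    let σ : X ⊕ Fin n ↪ X ⊕ Fin (n + 1) := Embedding.sumMap (.refl X) (Fin.succEmb n)
    have hset : {Sum.inr 0} ∪ (s.disjSum univ).map σ = s.disjSum univ := by
      ext (i | i)
      · simp [σ]
      · induction i using Fin.cases <;> simp [σ]
    have disj : Disjoint {Sum.inr 0} ((s.disjSum univ).map σ) := by
      simp [σ]
    refine Submodule.subset_span ⟨n + 1, fun φ => ⁅φ (Sum.inr 0), f (φ ∘ σ)⁆, Fin.cons a φ,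
      hset ▸ lie_mem_polyFun disj (var_mem_polyFun ρ _) (rename_mem_polyFun hf σ), ?_⟩
    funext ψ
    have : (Sum.elim ψ (Fin.cons a φ) : X ⊕ Fin (n + 1) → L) ∘ σ = Sum.elim ψ φ := by
      ext (i | i) <;> simp [σ]
    simp only [this, Sum.elim_inr, Fin.cons_zero]
  | zero => simp only [Pi.zero_apply, lie_zero]; exact zero_mem _
  | add f g _ _ hf hg => simpa only [Pi.add_apply, lie_add] using! add_mem hf hg
  | smul c f _ hf => simpa only [Pi.smul_apply, lie_smul] using! Submodule.smul_mem _ c hf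

theorem mul_mem_specializedFun (hρ : IsGeneralizedAction ρ) (hK : IsLinearOver K ρ)
    {T : Module.End F L} (hT : T ∈ multiplicationAlgebra ρ) (hp : p ∈ specializedFun K ρ s) :
    (fun ψ => T (p ψ)) ∈ specializedFun K ρ s := by
  induction hT using Algebra.adjoin_induction generalizing p with
  | mem T hT =>
    rcases hT with ⟨a, rfl⟩ | ⟨h, rfl⟩
    · exact lie_const_mem_specializedFun a hp
    · exact action_mem_specializedFun hρ hK h hp
  | algebraMap c =>
    rw [← ρ.commutes]
    exact action_mem_specializedFun hρ hK _ hp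
  | add _ _ _ _ hS hT => exact add_mem (hS hp) (hT hp)
  | mul _ _ _ _ hS hT => exact hS (hT hp)

theorem lie_var_mem_specializedFun {i : X} (hi : i ∉ s) (hp : p ∈ specializedFun K ρ s) :
    (fun ψ => ⁅ψ i, p ψ⁆) ∈ specializedFun K ρ (insert i s) := by
  induction hp using Submodule.span_induction with
  | mem p hp =>
    obtain ⟨n, f, φ, hf, rfl⟩ := hp
    have hset : {Sum.inl i} ∪ s.disjSum (univ : Finset (Fin n)) = (insert i s).disjSum univ := by
      ext (j | j) <;> simp
    exact Submodule.subset_span ⟨n, fun φ => ⁅φ (Sum.inl i), f φ⁆, φ, hset ▸ lie_mem_polyFun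
      (disjoint_singleton_left.2 (mt inl_mem_disjSum.1 hi)) (var_mem_polyFun ρ _) hf, rfl⟩
  | zero => simp only [Pi.zero_apply, lie_zero]; exact zero_mem _
  | add f g _ _ hf hg => simpa only [Pi.add_apply, lie_add] using! add_mem hf hg
  | smul c f _ hf => simpa only [Pi.smul_apply, lie_smul] using! Submodule.smul_mem _ c hf

variable {ι : Type*} [Fintype ι] [DecidableEq ι] (e : Basis ι K L)

/-- The signed sum of the values at all permutations of the basis `e`. -/
noncomputable def alternation : ((ι → L) → L) →ₗ[K] L :=
  ∑ σ : Equiv.Perm ι, Equiv.Perm.sign σ • LinearMap.proj (e ∘ σ)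

theorem alternation_prod_coord_smul (v : L) :
    alternation e (fun ψ => (∏ i, e.coord i (ψ i)) • v) = v := by
  have kronecker (σ : Equiv.Perm ι) :
      ∏ i, e.coord i (e (σ i)) = if σ = 1 then (1 : K) else 0 := by
    simp only [Basis.coord_apply, Basis.repr_self, Finsupp.single_apply, Fintype.prod_boole,
      Equiv.ext_iff, Equiv.Perm.one_apply]
  simp only [alternation, LinearMap.sum_apply, LinearMap.smul_apply, LinearMap.proj_apply,
    comp_apply, kronecker, ite_smul, one_smul, zero_smul, smul_ite, smul_zero, sum_ite_eq',
    mem_univ, if_true, Equiv.Perm.sign_one]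

variable [LieAlgebra.IsKilling K L]

/- Write `l i = κ(u, ·)` and compute the trace of `ad u ∘ ad (ψ i)` in a basis: by density, each
matrix entry times `v` is the image of a bracket under the multiplication algebra. -/
theorem prod_dual_smul_mem_specializedFun [FiniteDimensional K L]
    (hρ : IsGeneralizedAction ρ) (hK : IsLinearOver K ρ) (hdense : IsDenseOver K ρ)
    (l : X → Dual K L) (s : Finset X) (v : L) :
    (fun ψ => (∏ i ∈ s, l i (ψ i)) • v) ∈ specializedFun K ρ s := by
  induction s using Finset.induction_on generalizing v with
  | empty => simpa only [prod_empty, one_smul] using const_mem_specializedFun ρ v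
  | @insert i s hi ih =>
    let e := finBasis K L
    have hκ := LieAlgebra.IsKilling.killingForm_nondegenerate K L
    obtain ⟨u, hu⟩ : ∃ u : L, ∀ a, l i a = killingForm K L u a :=
      ⟨((killingForm K L).toDual hκ).symm (l i), fun a =>
        (LinearMap.BilinForm.apply_toDual_symm_apply ..).symm⟩
    have entry_mem (j) : (fun ψ : X → L =>
        e.coord j ⁅u, ⁅ψ i, (∏ i ∈ s, l i (ψ i)) • e j⁆⁆ • v) ∈
          specializedFun K ρ (insert i s) := by
      obtain ⟨T, hT, hT'⟩ := hdense (((e.coord j).comp (LieAlgebra.ad K L u)).smulRight v)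
      simpa [hT', mul_smul] using
        mul_mem_specializedFun hρ hK hT (lie_var_mem_specializedFun hi (ih (e j)))
    convert sum_mem fun j (_ : j ∈ univ) => entry_mem j using 1
    ext ψ
    rw [prod_insert hi, Finset.sum_apply, hu, killingForm_apply_apply,
      LinearMap.trace_eq_matrix_trace K e, Matrix.trace, ← sum_smul, sum_mul]
    congr 1
    refine sum_congr rfl fun j _ => ?_
    simp [LinearMap.toMatrix_apply, mul_comm]

theorem exists_alternation_ne_zero [Nontrivial L] (hρ : IsGeneralizedAction ρ)
    (hK : IsLinearOver K ρ) (hdense : IsDenseOver K ρ) :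
    ∃ (n : ℕ) (f : (ι ⊕ Fin n → L) → L) (φ : Fin n → L), f ∈ polyFun K ρ univ ∧
      alternation e (fun ψ => f (Sum.elim ψ φ)) ≠ 0 := by
  by_contra! h
  have := Module.Finite.of_basis e
  obtain ⟨v, hv⟩ := exists_ne (0 : L)
  have kills : specializedFun K ρ univ ≤ LinearMap.ker (alternation e) := by
    refine Submodule.span_le.2 ?_
    rintro _ ⟨n, f, φ, hf, rfl⟩
    exact h n f φ (univ_disjSum_univ (α := ι) (β := Fin n) ▸ hf)
  have mem := kills (prod_dual_smul_mem_specializedFun hρ hK hdense e.coord univ v)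
  exact hv ((alternation_prod_coord_smul e v).symm.trans mem)

theorem exists_isDetCofactor [Nontrivial L] (hρ : IsGeneralizedAction ρ) (hK : IsLinearOver K ρ)
    (hdense : IsDenseOver K ρ) :
    ∃ (n : ℕ) (g : (Fin n → L) → L), IsDetCofactor ρ e univ g ∧ g ≠ 0 := by
  obtain ⟨n, f, φ, hf, hφ⟩ := exists_alternation_ne_zero e hρ hK hdense
  let A : L [⋀^ι]→ₗ[K] MultilinearMap K (fun _ : Fin n => L) L :=
    MultilinearMap.alternatization (toMultilinearMap hK hf).currySum
  have A_apply (a : ι → L) (b : Fin n → L) :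
      A a b = ∑ σ : Equiv.Perm ι, Equiv.Perm.sign σ • f (Sum.elim (a ∘ σ) b) := by
    simp only [A, MultilinearMap.alternatization_apply, _root_.sum_apply]
    rfl
  refine ⟨n, A e, ?_, fun hA => hφ ?_⟩
  · rw [IsDetCofactor, univ_disjSum_univ]
    have permuted_mem (σ : Equiv.Perm ι) :=
      rename_equiv_mem_polyFun hf (Equiv.sumCongr σ (.refl (Fin n)))
    convert sum_mem fun σ (_ : σ ∈ univ) =>
      zsmul_mem (permuted_mem σ) ((Equiv.Perm.sign σ : ℤˣ) : ℤ) using 1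
    ext Φ
    have hA := congrArg (fun M => M (Φ ∘ Sum.inr))
      (alternatingMap_apply_eq_det_smul e A (Φ ∘ Sum.inl))
    rw [smul_apply, A_apply] at hA
    rw [← hA, Finset.sum_apply]
    refine sum_congr rfl fun σ _ => ?_
    have hΦ : Sum.elim ((Φ ∘ Sum.inl) ∘ σ) (Φ ∘ Sum.inr) = Φ ∘ Equiv.sumCongr σ (.refl _) := by
      ext (i | i) <;> rfl
    rw [hΦ, Units.smul_def]
    rfl
  · have hA := A_apply e φ ▸ congrFun hA φ
    simpa [alternation] using hA

theorem exists_isDetCofactor_of_le [Nontrivial L] (hρ : IsGeneralizedAction ρ)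
    (hK : IsLinearOver K ρ) (hdense : IsDenseOver K ρ) :
    ∃ n₀, ∀ n ≥ n₀, ∃ g : (Fin n → L) → L, IsDetCofactor ρ e univ g ∧ g ≠ 0 := by
  have := Module.Finite.of_basis e
  obtain ⟨n₀, g₀, hg₀⟩ := exists_isDetCofactor e hρ hK hdense
  refine ⟨n₀, fun n hn => ?_⟩
  induction n, hn using Nat.le_induction with
  | base => exact ⟨g₀, hg₀⟩
  | succ n _ ih =>
    obtain ⟨g, hg, hg'⟩ := ih
    obtain ⟨φ, hφ⟩ := ne_iff.1 hg'
    obtain ⟨a, ha⟩ : ∃ a : L, ⁅a, g φ⁆ ≠ 0 := by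
      by_contra! h
      exact hφ (by simpa using show g φ ∈ LieAlgebra.center K L from h)
    have hset : insert 0 (univ.map (Fin.succEmb n)) = univ := by
      ext i
      induction i using Fin.cases <;> simp
    refine ⟨fun φ => ⁅φ 0, g (φ ∘ Fin.succ)⁆, hset ▸ (hg.rename (Fin.succEmb n)).lie (by simp),
      ne_iff.2 ⟨Fin.cons a φ, ?_⟩⟩
    simpa [comp_def] using ha

end CofactorExistence

section Independence

variable {K V V' : Type*} [Field K] [AddCommGroup V] [Module K V] [AddCommGroup V'] [Module K V']

theorem linearIndependent_of_triangular {I X : Type*} [Finite I] {f : I → X → V} (x : I → X)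
    (w : I → ℕ) (hdiag : ∀ i, f i (x i) ≠ 0)
    (htri : ∀ i j, f i (x j) ≠ 0 → j = i ∨ w j < w i) : LinearIndependent K f := by
  have := Fintype.ofFinite I
  rw [Fintype.linearIndependent_iff]
  intro c hc
  by_contra! h
  obtain ⟨i, hi, hmax⟩ := Set.exists_max_image {i | c i ≠ 0} w (Set.toFinite _) h
  have hval := congrFun hc (x i)
  rw [Finset.sum_apply, Finset.sum_eq_single i] at hval
  · exact smul_ne_zero hi (hdiag i) hval
  · intro j _ hji
    by_contra hne
    obtain ⟨hcj, hfj⟩ := smul_ne_zero_iff.1 hne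
    exact (htri j i hfj).elim (fun h => hji h.symm) (hmax j hcj).not_gt
  · exact fun h => absurd (mem_univ i) h

theorem sum_mul_lt_of_strictMono {d : ℕ} {h : Fin d → ℕ} (hh : StrictMono h)
    {σ : Equiv.Perm (Fin d)} (hσ : σ ≠ 1) : ∑ r, h r * (σ r : ℕ) < ∑ r, h r * (r : ℕ) := by
  have hmono : Monovary h (Fin.val : Fin d → ℕ) := fun i j hij => (hh hij).le
  refine (hmono.sum_mul_comp_perm_lt_sum_mul_iff (σ := σ)).2 fun hvary => hσ ?_
  have σ_mono : StrictMono σ := Monotone.strictMono_of_injective (fun i j hij => by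
    by_contra! hlt
    exact hlt.ne' (congrArg σ (le_antisymm hij (hh.le_iff_le.1 (hvary hlt))))) σ.injective
  exact Equiv.ext fun r => congrArg (fun τ : Fin d ≃o Fin d => τ r) (Subsingleton.elim
    (StrictMono.orderIsoOfSurjective σ σ_mono σ.surjective) (OrderIso.refl (Fin d)))

theorem sum_mul_le_of_strictMono {d : ℕ} {h : Fin d → ℕ} (hh : StrictMono h)
    (σ : Equiv.Perm (Fin d)) : ∑ r, h r * (σ r : ℕ) ≤ ∑ r, h r * (r : ℕ) := by
  obtain rfl | hσ := eq_or_ne σ 1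
  · rfl
  · exact (sum_mul_lt_of_strictMono hh hσ).le

variable {I J T : Type*} [Finite I] [Fintype J] {d : ℕ}

/- Evaluate at the substitutions that send the variable `p` to the basis vector named by the letter
at `p` of one of the words. By the rearrangement inequality the matrix of values is triangular for
the order given by `∑ p, h p * letter p`. -/
theorem linearIndependent_prod_det (e : Basis (Fin d) K V) {h : J × Fin d → ℕ}
    (hmono : ∀ j, StrictMono fun r => h (j, r)) (π : I → Equiv.Perm (J × Fin d))
    (hπ : ∀ α, h ∘ π α = h) (hword : Injective fun α => Prod.snd ∘ π α)
    {G : (T → V) → V'} (hG : G ≠ 0) :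
    LinearIndependent K fun (α : I) (ψ : (J × Fin d) ⊕ T → V) =>
      (∏ j, e.det fun r => ψ (.inl ((π α).symm (j, r)))) • G (ψ ∘ Sum.inr) := by
  obtain ⟨φ, hφ⟩ := ne_iff.1 hG
  let letter (α : I) (p : J × Fin d) : Fin d := (π α p).2
  have letter_self (α : I) (j : J) (r : Fin d) : letter α ((π α).symm (j, r)) = r := by
    simp [letter]
  have weighted_sum (α β : I) : ∑ p, h p * (letter β p : ℕ) =
      ∑ j, ∑ r, h (j, r) * (letter β ((π α).symm (j, r)) : ℕ) := by
    rw [← Fintype.sum_prod_type', ← Equiv.sum_comp (π α).symm]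
    refine sum_congr rfl fun p _ => ?_
    rw [← congrFun (hπ α) ((π α).symm p), comp_apply, Equiv.apply_symm_apply]
  refine linearIndependent_of_triangular (fun α => Sum.elim (e ∘ letter α) φ)
    (fun α => ∑ p, h p * (letter α p : ℕ)) (fun α => ?_) fun α β hne => ?_
  · simpa [letter_self, e.det_self] using hφ
  · simp only [Sum.elim_inl, Sum.elim_comp_inr, comp_apply] at hne
    have column_injective (j : J) : Injective fun r => letter β ((π α).symm (j, r)) := by
      by_contra hj
      refine (smul_ne_zero_iff.1 hne).1 (prod_eq_zero (mem_univ j) ?_)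
      exact e.det.map_eq_zero_of_not_injective _ fun hi => hj fun a b hab => hi (congrArg e hab)
    let column (j : J) : Equiv.Perm (Fin d) :=
      .ofBijective _ (Finite.injective_iff_bijective.1 (column_injective j))
    simp only [weighted_sum α, letter_self]
    by_cases hid : ∀ j, column j = 1
    · left
      refine hword (funext fun p => ?_)
      have := Equiv.congr_fun (hid (π α p).1) (π α p).2
      simpa [column, letter] using this
    · right
      obtain ⟨j, hj⟩ := not_forall.1 hid
      exact sum_lt_sum (fun i _ => sum_mul_le_of_strictMono (hmono i) (column i))
        ⟨j, mem_univ j, sum_mul_lt_of_strictMono (hmono j) hj⟩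

end Independence

section Words

variable {P A B C : Type*} [Fintype P] [DecidableEq P] [DecidableEq A] [DecidableEq B]
  [DecidableEq C]

theorem card_perm_le_mul_card_image (h : P → A) (w : P → B) (v : P → C)
    (hv : ∀ p q, h p = h q → w p = w q → v p = v q) :
    Fintype.card {π : Equiv.Perm P // h ∘ π = h} ≤
      Fintype.card {π : Equiv.Perm P // v ∘ π = v} *
        (univ.image fun π : {π : Equiv.Perm P // h ∘ π = h} => w ∘ π.1).card := by
  refine card_le_mul_card_image univ _ fun _ hb => ?_
  obtain ⟨π₀, -, rfl⟩ := mem_image.1 hb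
  rw [← Fintype.card_coe]
  have fixes (π : {π : Equiv.Perm P // h ∘ π = h}) (hπ : w ∘ π.1 = w ∘ π₀.1) :
      v ∘ (π * (π₀ : Equiv.Perm P)⁻¹ : Equiv.Perm P) = v := by
    funext p
    have h_eq (σ : {π : Equiv.Perm P // h ∘ π = h}) (p : P) : h (σ.1 p) = h p := congrFun σ.2 p
    refine hv _ _ ?_ ?_
    · simpa [h_eq] using (h_eq π₀ ((π₀ : Equiv.Perm P)⁻¹ p)).symm
    · simpa using congrFun hπ ((π₀ : Equiv.Perm P)⁻¹ p)
  refine Fintype.card_le_of_injective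
    (fun π => ⟨π.1 * (π₀ : Equiv.Perm P)⁻¹, fixes π.1 (mem_filter.1 π.2).2⟩) fun π σ hπσ => ?_
  exact Subtype.ext (Subtype.ext (mul_right_cancel (congrArg Subtype.val hπσ)))

variable {u m d : ℕ}

/-- The height of a box of `(u + d) * m` columns of height `d`. The columns are arranged in `u + d`
groups of `m`, and the `i`-th group is raised by `i`, so that the heights `d, …, u + d - 1` occur
in every row. -/
def boxHeight (p : (Fin (u + d) × Fin m) × Fin d) : ℕ := p.1.1 + p.2

theorem strictMono_boxHeight (j : Fin (u + d) × Fin m) :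
    StrictMono fun r : Fin d => boxHeight (j, r) :=
  fun _ _ hr => Nat.add_lt_add_left hr _

theorem card_boxHeight_eq (k : Fin u) :
    Fintype.card {p : (Fin (u + d) × Fin m) × Fin d // boxHeight p = k + d} = m * d := by
  suffices e : {p : (Fin (u + d) × Fin m) × Fin d // boxHeight p = k + d} ≃ Fin m × Fin d by
    rw [Fintype.card_congr e, Fintype.card_prod, Fintype.card_fin, Fintype.card_fin]
  refine
    { toFun := fun p => (p.1.1.2, p.1.2)
      invFun := fun q => ⟨((⟨k + d - q.2, by omega⟩, q.1), q.2), by simp [boxHeight]; omega⟩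
      left_inv := ?_
      right_inv := fun q => rfl }
  rintro ⟨⟨⟨i, j⟩, r⟩, h⟩
  simp only [boxHeight] at h
  ext <;> simp
  omega

theorem factorial_pow_le_card_perm_boxHeight (hm : 0 < m) (hd : 0 < d) :
    (m * d).factorial ^ u ≤
      Fintype.card {π : Equiv.Perm ((Fin (u + d) × Fin m) × Fin d) //
        boxHeight ∘ π = boxHeight} := by
  let layer : Fin u ↪ ℕ := ⟨fun k => k + d, fun k l => by simp [Fin.ext_iff]⟩
  have layers_subset : univ.map layer ⊆
      univ.image (boxHeight : (Fin (u + d) × Fin m) × Fin d → ℕ) := by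
    intro _ hk
    obtain ⟨k, -, rfl⟩ := Finset.mem_map.1 hk
    exact mem_image.2 ⟨((⟨k + d, by omega⟩, ⟨0, hm⟩), ⟨0, hd⟩), mem_univ _, rfl⟩
  rw [DomMulAct.stabilizer_card']
  refine le_trans (le_of_eq ?_) (prod_le_prod_of_subset_of_one_le' layers_subset
    fun _ _ _ => Nat.factorial_pos _)
  have layer_card (k : Fin u) :
      Fintype.card {p : (Fin (u + d) × Fin m) × Fin d // boxHeight p = layer k} = m * d :=
    card_boxHeight_eq k
  simp only [prod_map, layer_card, prod_const, card_univ, Fintype.card_fin]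

theorem card_perm_row_column :
    Fintype.card {π : Equiv.Perm ((Fin (u + d) × Fin m) × Fin d) //
      (fun p => (p.1.1, p.2)) ∘ π = fun p => (p.1.1, p.2)} = m.factorial ^ ((u + d) * d) := by
  have fiber_card (q : Fin (u + d) × Fin d) :
      Fintype.card {p : (Fin (u + d) × Fin m) × Fin d // (p.1.1, p.2) = q} = m := by
    suffices e : {p : (Fin (u + d) × Fin m) × Fin d // (p.1.1, p.2) = q} ≃ Fin m by
      rw [Fintype.card_congr e, Fintype.card_fin]
    exact
      { toFun := fun p => p.1.1.2
        invFun := fun j => ⟨((q.1, j), q.2), rfl⟩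
        left_inv := by rintro ⟨⟨⟨i, j⟩, r⟩, rfl⟩; rfl
        right_inv := fun _ => rfl }
  rw [DomMulAct.stabilizer_card]
  simp [fiber_card]

end Words

section GrowthLowerBound

variable {F K L H X : Type*} [Field F] [LieRing L] [LieAlgebra F L] [Ring H] [Algebra F H]
  [Field K] [LieAlgebra K L] [Fintype X] [DecidableEq X] {ρ : H →ₐ[F] Module.End F L} {d : ℕ}
  [LieAlgebra.IsKilling K L]

theorem IsDetCofactor.prod_det_perm_mem_polyFun {e : Basis (Fin d) K L} {g : (X → L) → L}
    (hρ : IsGeneralizedAction ρ) (hK : IsLinearOver K ρ) (h : IsDetCofactor ρ e univ g)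
    {J : Type*} [Fintype J] [DecidableEq J] (hJ : Even (Fintype.card J))
    (π : Equiv.Perm (J × Fin d)) :
    (fun φ : (J × Fin d) ⊕ (Fin d ⊕ X) → L => (∏ j, e.det fun r => φ (.inl (π.symm (j, r)))) •
      e.det ((φ ∘ Sum.inr) ∘ Sum.inl) • g ((φ ∘ Sum.inr) ∘ Sum.inr)) ∈ polyFun K ρ univ := by
  have mem := h.prod_det_smul hρ hK (S := (univ : Finset J)) hJ
  rw [univ_product_univ, univ_disjSum_univ, IsDetCofactor, univ_disjSum_univ] at mem
  let σ : Fin d ⊕ ((J × Fin d) ⊕ X) ≃ (J × Fin d) ⊕ (Fin d ⊕ X) :=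
    (Equiv.sumCongr (.refl _) (Equiv.sumCongr π.symm (.refl _))).trans <|
      (Equiv.sumAssoc ..).symm.trans <| (Equiv.sumCongr (Equiv.sumComm ..) (.refl _)).trans <|
        Equiv.sumAssoc ..
  convert rename_equiv_mem_polyFun mem σ using 2 with φ
  exact smul_comm ..

theorem exists_factorial_pow_le_mul_hCodim [Algebra F K] [IsScalarTower F K L] [Nontrivial L]
    [FiniteDimensional F L] (hρ : IsGeneralizedAction ρ) (hK : IsLinearOver K ρ)
    (hdense : IsDenseOver K ρ) (e : Basis (Fin d) K L) :
    ∃ n₀, ∀ n ≥ n₀, ∀ m u : ℕ, 0 < m → Even m → (m * d).factorial ^ u ≤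
      m.factorial ^ ((u + d) * d) * hCodim ρ ((u + d) * m * d + (d + n)) := by
  obtain ⟨n₀, hn₀⟩ := exists_isDetCofactor_of_le e hρ hK hdense
  refine ⟨n₀, fun n hn m u hm hm' => ?_⟩
  obtain ⟨g, hg, hg'⟩ := hn₀ n hn
  have hd : 0 < d := e.index_nonempty.elim Fin.pos
  have det_smul_ne_zero :
      (fun ψ : Fin d ⊕ Fin n → L => e.det (ψ ∘ Sum.inl) • g (ψ ∘ Sum.inr)) ≠ 0 := by
    obtain ⟨φ, hφ⟩ := ne_iff.1 hg'
    exact ne_iff.2 ⟨Sum.elim e φ, by simpa [e.det_self] using hφ⟩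
  let Box := (Fin (u + d) × Fin m) × Fin d
  let words := univ.image fun π : {π : Equiv.Perm Box // boxHeight ∘ π = boxHeight} =>
    Prod.snd ∘ π.1
  choose π _ hπ using fun w : words => mem_image.1 w.2
  have independent := linearIndependent_prod_det e strictMono_boxHeight (fun w => (π w).1)
    (fun w => (π w).2) (fun w w' h => Subtype.ext ((hπ w).symm.trans (h.trans (hπ w'))))
    det_smul_ne_zero
  have words_le : words.card ≤ hCodim ρ ((u + d) * m * d + (d + n)) := by
    simpa using card_le_hCodim (F := F) (ρ := ρ) independent
      fun w => hg.prod_det_perm_mem_polyFun hρ hK (by simp [hm'.mul_left]) _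
  calc (m * d).factorial ^ u ≤ _ := factorial_pow_le_card_perm_boxHeight hm hd
    _ ≤ _ := card_perm_le_mul_card_image (P := Box) boxHeight Prod.snd (fun p => (p.1.1, p.2))
        fun p q h_height h_row => by
          simp only [boxHeight, h_row, add_left_inj] at h_height
          exact Prod.ext (Fin.ext h_height) h_row
    _ ≤ _ := by
      rw [card_perm_row_column]
      exact Nat.mul_le_mul_left _ words_le

end GrowthLowerBound

section ExponentialGrowth

/-- The sequence `c` grows like `d ^ n`: it is at most a constant times `d ^ n`, and eventually at
least a constant times `x ^ n` for every `x < d`. This is stronger than `c n ^ (1 / n) → d` and,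
unlike it, is stable under the comparison `of_le_sum`. -/
structure HasExponentialGrowth (c : ℕ → ℕ) (d : ℕ) : Prop where
  upper : ∃ C : ℕ, ∀ n, c n ≤ C * d ^ n
  lower : ∀ x : ℝ, 0 < x → x < d → ∃ A : ℝ, 0 < A ∧ ∀ᶠ n in atTop, A * x ^ n ≤ c n

theorem tendsto_mul_pow_rpow_one_div {A x : ℝ} (hA : 0 < A) (hx : 0 ≤ x) :
    Tendsto (fun n : ℕ => (A * x ^ n) ^ (1 / (n : ℝ))) atTop (𝓝 x) := by
  have hA_root : Tendsto (fun n : ℕ => A ^ (1 / (n : ℝ))) atTop (𝓝 1) := by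
    simpa using tendsto_const_nhds.rpow tendsto_one_div_atTop_nhds_zero_nat (Or.inl hA.ne')
  refine Tendsto.congr' ?_ (by simpa using hA_root.mul_const x)
  filter_upwards [eventually_ne_atTop 0] with n hn
  rw [Real.mul_rpow hA.le (pow_nonneg hx n), one_div, Real.pow_rpow_inv_natCast hx hn]

namespace HasExponentialGrowth

variable {c : ℕ → ℕ} {d : ℕ}

theorem tendsto_rpow_one_div (h : HasExponentialGrowth c d) :
    Tendsto (fun n : ℕ => (c n : ℝ) ^ (1 / (n : ℝ))) atTop (𝓝 (d : ℝ)) := by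
  refine tendsto_order.2 ⟨fun a ha => ?_, fun a ha => ?_⟩
  · rcases lt_or_ge a 0 with ha' | ha'
    · exact .of_forall fun n => ha'.trans_le (by positivity)
    · obtain ⟨x, hax, hxd⟩ := exists_between ha
      obtain ⟨A, hA, hlower⟩ := h.lower x (ha'.trans_lt hax) hxd
      have hlim := tendsto_mul_pow_rpow_one_div hA (ha'.trans hax.le)
      filter_upwards [hlower, hlim.eventually (lt_mem_nhds hax)] with n hn hn'
      have hx : 0 ≤ x := ha'.trans hax.le
      exact hn'.trans_le (Real.rpow_le_rpow (by positivity) hn (by positivity))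
  · obtain ⟨C, hC⟩ := h.upper
    have hlim := tendsto_mul_pow_rpow_one_div (A := C + 1) (by positivity) d.cast_nonneg
    filter_upwards [hlim.eventually (gt_mem_nhds ha)] with n hn
    refine (Real.rpow_le_rpow (by positivity) ?_ (by positivity)).trans_lt hn
    calc (c n : ℝ) ≤ C * (d : ℝ) ^ n := by exact_mod_cast hC n
      _ ≤ (C + 1) * (d : ℝ) ^ n := by gcongr; linarith

theorem of_le_sum {I : Type*} [Fintype I] {b : I → ℕ → ℕ} {d : I → ℕ}
    (hb : ∀ i, HasExponentialGrowth (b i) (d i)) (hbc : ∀ i n, b i n ≤ c n)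
    (hcb : ∀ n, c n ≤ ∑ i, b i n) : HasExponentialGrowth c (univ.sup d) where
  upper := by
    choose C hC using fun i => (hb i).upper
    refine ⟨∑ i, C i, fun n => (hcb n).trans ?_⟩
    rw [sum_mul]
    exact sum_le_sum fun i _ => (hC i n).trans <|
      Nat.mul_le_mul_left _ (Nat.pow_le_pow_left (le_sup (mem_univ i)) n)
  lower x hx hxd := by
    have nonempty : (univ : Finset I).Nonempty := by
      by_contra! hempty
      simp [hempty, hx.not_gt] at hxd
    obtain ⟨i, -, hi⟩ := exists_mem_eq_sup _ nonempty d
    obtain ⟨A, hA, hlower⟩ := (hb i).lower x hx (hi ▸ hxd)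
    exact ⟨A, hA, hlower.mono fun n hn => hn.trans (by exact_mod_cast hbc i n)⟩

end HasExponentialGrowth

theorem factorial_pow_mul_pow_le (m d : ℕ) (hm : 0 < m) :
    m.factorial ^ d * d ^ (m * d) ≤ (m * d).factorial * (m * d) ^ d := by
  induction m, hm using Nat.le_induction with
  | base => simpa using Nat.le_mul_of_pos_left _ d.factorial_pos
  | succ m _ ih =>
    have factorial_step : (m * d).factorial * (m * d) ^ d ≤ ((m + 1) * d).factorial := by
      rw [add_mul, one_mul]
      exact (Nat.mul_le_mul_left _ (Nat.pow_le_pow_left (Nat.le_succ _) d)).trans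
        Nat.factorial_mul_pow_le_factorial
    calc (m + 1).factorial ^ d * d ^ ((m + 1) * d)
        = (m.factorial ^ d * d ^ (m * d)) * ((m + 1) * d) ^ d := by
          rw [Nat.factorial_succ, mul_pow, mul_pow, add_mul, one_mul, pow_add]; ring
      _ ≤ ((m + 1) * d).factorial * ((m + 1) * d) ^ d :=
          Nat.mul_le_mul_right _ (ih.trans factorial_step)

theorem eventually_pow_mul_factorial_pow_le {x : ℝ} {d : ℕ} (hx : 0 < x) (hxd : x < d) :
    ∀ᶠ m : ℕ in atTop, x ^ (m * d) * (m.factorial : ℝ) ^ d ≤ (m * d).factorial := by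
  have hd : (0 : ℝ) < d := hx.trans hxd
  have hlim : Tendsto (fun m : ℕ => m * (x / d) ^ m * d) atTop (𝓝 0) := by
    simpa using (tendsto_self_mul_const_pow_of_lt_one (by positivity)
      ((div_lt_one hd).2 hxd)).mul_const (d : ℝ)
  filter_upwards [hlim.eventually (gt_mem_nhds one_pos), eventually_gt_atTop 0] with m hm hm0
  have root_bound : x ^ m * (m * d) ≤ (d : ℝ) ^ m := by
    rw [div_pow, mul_div_assoc', div_mul_eq_mul_div, div_lt_one (by positivity)] at hm
    linarith
  have hpos : (0 : ℝ) < ((m : ℝ) * d) ^ d := by positivity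
  refine le_of_mul_le_mul_right ?_ hpos
  calc x ^ (m * d) * (m.factorial : ℝ) ^ d * (m * d) ^ d
      = m.factorial ^ d * (x ^ m * (m * d)) ^ d := by ring
    _ ≤ m.factorial ^ d * ((d : ℝ) ^ m) ^ d := by gcongr
    _ = ((m.factorial ^ d * d ^ (m * d) : ℕ) : ℝ) := by push_cast; ring
    _ ≤ ((m * d).factorial * (m * d) ^ d : ℕ) := by
        exact_mod_cast factorial_pow_mul_pow_le m d hm0
    _ = (m * d).factorial * ((m : ℝ) * d) ^ d := by push_cast; ring

theorem exists_mul_pow_le_of_arithmetic_progressions {c : ℕ → ℕ} {x A : ℝ} {q s₀ : ℕ} (hx : 0 < x)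
    (hA : 0 < A) (hq : 0 < q) (h : ∀ u, ∀ s ≥ s₀, x ^ (q * u) ≤ A * c (q * u + s)) :
    ∃ B : ℝ, 0 < B ∧ ∀ᶠ n in atTop, B * x ^ n ≤ c n := by
  have hM : 0 < A * max 1 x ^ (s₀ + q) := by positivity
  refine ⟨(A * max 1 x ^ (s₀ + q))⁻¹, inv_pos.2 hM, ?_⟩
  filter_upwards [eventually_ge_atTop s₀] with n hn
  rw [inv_mul_le_iff₀ hM]
  obtain ⟨u, s, hs, hs', rfl⟩ : ∃ u s, s₀ ≤ s ∧ s ≤ s₀ + q ∧ n = q * u + s := by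
    have := Nat.div_add_mod (n - s₀) q
    have := Nat.mod_lt (n - s₀) hq
    exact ⟨(n - s₀) / q, s₀ + (n - s₀) % q, by omega, by omega, by omega⟩
  have pow_le : x ^ s ≤ max 1 x ^ (s₀ + q) :=
    (pow_le_pow_left₀ hx.le (le_max_right 1 x) s).trans
      (pow_le_pow_right₀ (le_max_left 1 x) hs')
  calc x ^ (q * u + s) = x ^ s * x ^ (q * u) := by ring
    _ ≤ max 1 x ^ (s₀ + q) * (A * c (q * u + s)) := by gcongr; exact h u s hs
    _ = A * max 1 x ^ (s₀ + q) * c (q * u + s) := by ring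

theorem exists_mul_pow_le_of_factorial_pow_le {c : ℕ → ℕ} {d n₀ : ℕ}
    (h : ∀ n ≥ n₀, ∀ m u : ℕ, 0 < m → Even m → (m * d).factorial ^ u ≤
      m.factorial ^ ((u + d) * d) * c ((u + d) * m * d + (d + n)))
    {x : ℝ} (hx : 0 < x) (hxd : x < d) : ∃ B : ℝ, 0 < B ∧ ∀ᶠ n in atTop, B * x ^ n ≤ c n := by
  obtain ⟨M, hM⟩ := eventually_atTop.1 (eventually_pow_mul_factorial_pow_le hx hxd)
  obtain ⟨m, hm, hm', hMm⟩ : ∃ m, 0 < m ∧ Even m ∧ M ≤ m :=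
    ⟨2 * (M + 1), by omega, even_two_mul _, by omega⟩
  have hd : 0 < d := by exact_mod_cast hx.trans hxd
  have hfact : (0 : ℝ) < m.factorial := by exact_mod_cast m.factorial_pos
  refine exists_mul_pow_le_of_arithmetic_progressions (A := (m.factorial : ℝ) ^ (d * d))
    (q := m * d) (s₀ := d * (m * d) + d + n₀) hx (by positivity) (by positivity) fun u s hs => ?_
  obtain ⟨n, rfl⟩ := Nat.exists_eq_add_of_le hs
  have bound : ((m * d).factorial : ℝ) ^ u ≤
      m.factorial ^ ((u + d) * d) * c ((u + d) * m * d + (d + (n₀ + n))) := by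
    exact_mod_cast h (n₀ + n) (by omega) m u hm hm'
  rw [show m * d * u + (d * (m * d) + d + n₀ + n) = (u + d) * m * d + (d + (n₀ + n)) by ring]
  refine le_of_mul_le_mul_right ?_ (pow_pos (pow_pos hfact d) u)
  calc x ^ (m * d * u) * ((m.factorial : ℝ) ^ d) ^ u
      = (x ^ (m * d) * m.factorial ^ d) ^ u := by ring
    _ ≤ ((m * d).factorial : ℝ) ^ u := by gcongr; exact hM m hMm
    _ ≤ _ := bound
    _ = _ := by ring

end ExponentialGrowth

section Centroid

theorem trace_restrictScalars {F K V : Type*} [Field F] [Field K] [Algebra F K] [AddCommGroup V]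
    [Module F V] [Module K V] [IsScalarTower F K V] [FiniteDimensional F K]
    [FiniteDimensional K V] (T : Module.End K V) :
    LinearMap.trace F V (T.restrictScalars F) = Algebra.trace F K (LinearMap.trace K V T) := by
  let b := finBasis F K
  let e := finBasis K V
  rw [LinearMap.trace_eq_matrix_trace F (b.smulTower e), LinearMap.trace_eq_matrix_trace K e,
    Algebra.trace_apply, LinearMap.trace_eq_matrix_trace F b]
  simp only [Matrix.trace, Matrix.diag_apply, LinearMap.toMatrix_apply, Fintype.sum_prod_type]
  refine sum_congr rfl fun i _ => ?_
  simp [Basis.smulTower_repr, Basis.smulTower_apply, mul_comm]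

variable {F L H : Type*} [Field F] [LieRing L] [LieAlgebra F L] [Ring H] [Algebra F H]
  {ρ : H →ₐ[F] Module.End F L}

section Tower

variable (F) (K : Type*) [Field K] [LieAlgebra K L] [Algebra F K] [IsScalarTower F K L]
  [FiniteDimensional F L] [LieAlgebra.IsKilling F L]

theorem isKilling_of_isScalarTower [FiniteDimensional F K] : LieAlgebra.IsKilling K L where
  killingCompl_top_eq_bot := by
    have := FiniteDimensional.right F K L
    refine (LieSubmodule.eq_bot_iff _).2 fun a ha =>
      (LieAlgebra.IsKilling.killingForm_nondegenerate F L).1 a fun b => ?_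
    rw [LieIdeal.mem_killingCompl] at ha
    calc killingForm F L a b
        = Algebra.trace F K (killingForm K L a b) :=
          trace_restrictScalars (LieAlgebra.ad K L a ∘ₗ LieAlgebra.ad K L b)
      _ = 0 := by rw [LieModule.traceForm_comm, ha b (LieSubmodule.mem_top b), map_zero]

variable {F}

theorem hasExponentialGrowth_hCodim [FiniteDimensional F K] [Nontrivial L]
    (hρ : IsGeneralizedAction ρ) (hK : IsLinearOver K ρ) (hdense : IsDenseOver K ρ) :
    HasExponentialGrowth (hCodim ρ) (finrank K L) where
  upper := by
    have := FiniteDimensional.right F K L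
    exact ⟨finrank F L, fun n => by simpa using hCodim_le hK (finBasis K L) n⟩
  lower x hx hxd := by
    have := FiniteDimensional.right F K L
    have := isKilling_of_isScalarTower (L := L) F K
    obtain ⟨n₀, h⟩ := exists_factorial_pow_le_mul_hCodim hρ hK hdense (finBasis K L)
    exact exists_mul_pow_le_of_factorial_pow_le h hx hxd

end Tower

/-- The centroid of `L` relative to the action of `H`: the operators that commute with the adjoint
action of `L` and with the action of `H`. -/
abbrev Centroid (ρ : H →ₐ[F] Module.End F L) : Type _ := Module.End (multiplicationAlgebra ρ) L

theorem ad_mem_multiplicationAlgebra (ρ : H →ₐ[F] Module.End F L) (a : L) :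
    LieAlgebra.ad F L a ∈ multiplicationAlgebra ρ :=
  Algebra.subset_adjoin (Or.inl ⟨a, rfl⟩)

theorem action_mem_multiplicationAlgebra (ρ : H →ₐ[F] Module.End F L) (h : H) :
    ρ h ∈ multiplicationAlgebra ρ :=
  Algebra.subset_adjoin (Or.inr ⟨h, rfl⟩)

namespace Centroid

theorem apply_lie (T : Centroid ρ) (a b : L) : T ⁅a, b⁆ = ⁅a, T b⁆ :=
  T.map_smul ⟨LieAlgebra.ad F L a, ad_mem_multiplicationAlgebra ρ a⟩ b

theorem apply_action (T : Centroid ρ) (h : H) (a : L) : T (ρ h a) = ρ h (T a) :=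
  T.map_smul ⟨ρ h, action_mem_multiplicationAlgebra ρ h⟩ a

theorem mul_apply_lie (S T : Centroid ρ) (a b : L) : (S * T) ⁅a, b⁆ = ⁅S a, T b⁆ := by
  rw [Module.End.mul_apply, T.apply_lie, ← lie_skew, map_neg, S.apply_lie, lie_skew]

end Centroid

namespace IsHSimple

theorem exists_lie_ne_zero (hs : IsHSimple ρ) : ∃ a b : L, ⁅a, b⁆ ≠ 0 := by
  by_contra! h
  exact hs.1 ⟨h⟩

theorem nontrivial (hs : IsHSimple ρ) : Nontrivial L :=
  let ⟨_, _, hab⟩ := hs.exists_lie_ne_zero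
  ⟨_, _, hab⟩

theorem isSimpleModule (hs : IsHSimple ρ) : IsSimpleModule (multiplicationAlgebra ρ) L := by
  have := hs.nontrivial
  refine isSimpleModule_iff _ _ |>.2 { eq_bot_or_eq_top := fun N => ?_ }
  let I : LieIdeal F L :=
    { N.restrictScalars F with
      lie_mem := fun {a _} hb =>
        N.smul_mem ⟨LieAlgebra.ad F L a, ad_mem_multiplicationAlgebra ρ a⟩ hb }
  have invariant : IsHInvariant ρ I := fun h _ ha =>
    N.smul_mem ⟨ρ h, action_mem_multiplicationAlgebra ρ h⟩ ha
  refine (hs.2 I invariant).imp (fun hI => ?_) fun hI => ?_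
  · exact (Submodule.eq_bot_iff N).2 fun a ha => (LieSubmodule.eq_bot_iff I).1 hI a ha
  · exact Submodule.eq_top_iff'.2 fun a => (hI ▸ LieSubmodule.mem_top a : a ∈ I)

theorem centroid_mul_comm (hs : IsHSimple ρ) (S T : Centroid ρ) : S * T = T * S := by
  have := hs.isSimpleModule
  obtain ⟨a, b, hab⟩ := hs.exists_lie_ne_zero
  by_contra! hne
  have injective : Injective (S * T - T * S) :=
    (LinearMap.injective_or_eq_zero _).resolve_right (sub_ne_zero.2 hne)
  refine hab (injective ?_)
  rw [map_zero, LinearMap.sub_apply, S.mul_apply_lie, ← lie_skew a b, map_neg, T.mul_apply_lie,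
    lie_skew, sub_self]

open Classical in
/-- The field structure on the centroid of an `H`-simple Lie algebra, from Schur's lemma. -/
@[reducible] noncomputable def centroidField (hs : IsHSimple ρ) : Field (Centroid ρ) :=
  letI := hs.isSimpleModule
  { (inferInstance : DivisionRing (Centroid ρ)) with mul_comm := hs.centroid_mul_comm }

theorem finrank_centroid (hs : IsHSimple ρ) (hc : IsHCentral ρ) :
    finrank (Centroid ρ) L = finrank F L := by
  let _ : Field (Centroid ρ) := hs.centroidField
  have finrank_eq_one : finrank F (Centroid ρ) = 1 := by
    refine (finrank_eq_one_iff_of_nonzero' (1 : Centroid ρ) one_ne_zero).2 fun T => ?_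
    obtain ⟨c, hc⟩ := hc (T.restrictScalars F) T.apply_lie T.apply_action
    exact ⟨c, LinearMap.ext fun a => (hc a).symm⟩
  rw [← finrank_mul_finrank F (Centroid ρ) L, finrank_eq_one, one_mul]

variable [FiniteDimensional F L]

theorem finiteDimensional_centroid (hs : IsHSimple ρ) : FiniteDimensional F (Centroid ρ) := by
  let _ := hs.centroidField
  have := hs.nontrivial
  obtain ⟨v, hv⟩ := exists_ne (0 : L)
  exact Module.Finite.of_injective
    ((LinearMap.toSpanSingleton (Centroid ρ) L v).restrictScalars F)
    (smul_left_injective (Centroid ρ) hv)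

theorem hasExponentialGrowth [LieAlgebra.IsKilling F L] (hs : IsHSimple ρ)
    (hρ : IsGeneralizedAction ρ) :
    HasExponentialGrowth (hCodim ρ) (finrank (Centroid ρ) L) := by
  have := hs.isSimpleModule
  have := hs.nontrivial
  have := hs.finiteDimensional_centroid
  let _ : Field (Centroid ρ) := hs.centroidField
  let _ : LieAlgebra (Centroid ρ) L := { lie_smul := fun T a b => (T.apply_lie a b).symm }
  have := Module.Finite.of_restrictScalars_finite F (Centroid ρ) L
  refine hasExponentialGrowth_hCodim (Centroid ρ) hρ (fun h T a => (T.apply_action h a).symm)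
    fun T => ?_
  obtain ⟨T', hT'⟩ :=
    Module.Finite.toModuleEnd_moduleEnd_surjective (R := multiplicationAlgebra ρ) (M := L) T
  exact ⟨T'.1, T'.2, fun a => LinearMap.congr_fun hT' a⟩

theorem isHCentral [IsAlgClosed F] (hs : IsHSimple ρ) : IsHCentral ρ := by
  intro T hT hTρ
  have := hs.nontrivial
  obtain ⟨c, hc⟩ := Module.End.exists_eigenvalue T
  obtain ⟨v, hv⟩ := hc.exists_hasEigenvector
  let E : LieIdeal F L :=
    { Module.End.eigenspace T c with
      lie_mem := fun {a b} hb => Module.End.mem_eigenspace_iff.2 <| by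
        rw [hT, Module.End.mem_eigenspace_iff.1 hb, lie_smul] }
  have mem_E (a : L) : a ∈ E ↔ T a = c • a := Module.End.mem_eigenspace_iff
  have invariant : IsHInvariant ρ E := fun h a ha => by
    rw [mem_E] at ha ⊢
    rw [hTρ, ha, map_smul]
  have hE : E ≠ ⊥ := fun h => hv.2 ((LieSubmodule.eq_bot_iff E).1 h v hv.1)
  have E_eq_top := (hs.2 E invariant).resolve_left hE
  exact ⟨c, fun a => (mem_E a).1 (E_eq_top ▸ LieSubmodule.mem_top a)⟩

end IsHSimple

end Centroid

section InvariantIdeals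

theorem finrank_map_mkQ_anti {F M : Type*} [Field F] [AddCommGroup M] [Module F M]
    (V : Submodule F M) {A B : Submodule F M} (hAB : A ≤ B)
    [FiniteDimensional F (V.map A.mkQ)] : finrank F (V.map B.mkQ) ≤ finrank F (V.map A.mkQ) := by
  rw [← Submodule.factor_comp_mk hAB, Submodule.map_comp]
  exact Submodule.finrank_map_le _ _

theorem finrank_map_mkQ_le_sum {F M ι : Type*} [Field F] [AddCommGroup M] [Module F M] [Fintype ι]
    {V B : Submodule F M} {A : ι → Submodule F M} (hBA : ∀ i, B ≤ A i) (hAB : V ⊓ ⨅ i, A i ≤ B)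
    [∀ i, FiniteDimensional F (V.map (A i).mkQ)] :
    finrank F (V.map B.mkQ) ≤ ∑ i, finrank F (V.map (A i).mkQ) := by
  let Θ : V.map B.mkQ →ₗ[F] ∀ i, V.map (A i).mkQ := LinearMap.pi fun i =>
    (Submodule.factor (hBA i)).restrict (by rintro _ ⟨v, hv, rfl⟩; exact ⟨v, hv, rfl⟩)
  have injective : Injective Θ := by
    rw [injective_iff_map_eq_zero]
    rintro ⟨_, v, hv, rfl⟩ hΘ
    have mem_A (i : ι) : v ∈ A i :=
      (Submodule.Quotient.mk_eq_zero (A i)).1 (congrArg Subtype.val (congrFun hΘ i))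
    exact Subtype.ext ((Submodule.Quotient.mk_eq_zero B).2
      (hAB ⟨hv, Submodule.mem_iInf A |>.2 mem_A⟩))
  exact (LinearMap.finrank_le_finrank_of_injective injective).trans_eq (finrank_pi_fintype F)

variable {F L H : Type*} [Field F] [LieRing L] [LieAlgebra F L]

theorem isKilling_lieIdeal [FiniteDimensional F L] [LieAlgebra.IsKilling F L] (I : LieIdeal F L) :
    LieAlgebra.IsKilling F I where
  killingCompl_top_eq_bot := by
    refine (LieSubmodule.eq_bot_iff _).2 fun a ha => Subtype.ext ?_
    have mem_killingCompl : (a : L) ∈ I.killingCompl := I.mem_killingCompl.2 fun b hb => by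
      have := (LieIdeal.mem_killingCompl ..).1 ha ⟨b, hb⟩ (LieSubmodule.mem_top _)
      rwa [I.killingForm_eq] at this
    have := (LieIdeal.isCompl_killingCompl I).inf_eq_bot
    exact (LieSubmodule.eq_bot_iff _).1 this a ⟨a.2, mem_killingCompl⟩

variable [Ring H] [Algebra F H] {ρ : H →ₐ[F] Module.End F L}

theorem IsGeneralizedAction.restrictAction (hρ : IsGeneralizedAction ρ) (I : LieIdeal F L)
    (hI : IsHInvariant ρ I) : IsGeneralizedAction (restrictAction ρ I hI) := by
  intro h
  obtain ⟨k, h', h'', hk⟩ := hρ h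
  refine ⟨k, h', h'', fun a b => Subtype.ext ?_⟩
  rw [AddSubmonoidClass.coe_finsetSum]
  exact hk a b

theorem evalAt_coe (I : LieIdeal F L) (hI : IsHInvariant ρ I) (φ : ℕ → I) (f : HPoly F H) :
    evalAt ρ (fun j => φ j) f = evalAt (restrictAction ρ I hI) φ f := by
  have : evalAt ρ (fun j => φ j) = I.incl.comp (evalAt (restrictAction ρ I hI) φ) := by
    ext p
    simp only [evalAt, LieHom.comp_apply, FreeLieAlgebra.lift_of_apply]
    rfl
  exact LieHom.congr_fun this f

theorem hIdentities_le_restrictAction (I : LieIdeal F L) (hI : IsHInvariant ρ I) :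
    hIdentities ρ ≤ hIdentities (restrictAction ρ I hI) := fun f hf => by
  rw [mem_hIdentities] at hf ⊢
  exact fun φ => Subtype.ext ((evalAt_coe I hI φ f).symm.trans (hf _))

theorem hCodim_restrictAction_le [FiniteDimensional F L] (I : LieIdeal F L)
    (hI : IsHInvariant ρ I) (n : ℕ) : hCodim (restrictAction ρ I hI) n ≤ hCodim ρ n :=
  finrank_map_mkQ_anti _ (hIdentities_le_restrictAction I hI)

theorem lie_eq_zero_of_disjoint {I J : LieIdeal F L} (hIJ : Disjoint I J) {a b : L} (ha : a ∈ I)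
    (hb : b ∈ J) : ⁅a, b⁆ = 0 :=
  (LieSubmodule.eq_bot_iff _).1 hIJ.eq_bot _ ⟨lie_mem_left F L I a b ha, J.lie_mem hb⟩

variable {ι : Type*} [Fintype ι] {I : ι → LieIdeal F L}

theorem IsMultilinearMonomial.evalAt_sum (hdisj : Pairwise (Disjoint on I))
    (hinv : ∀ i, IsHInvariant ρ (I i)) {s : Finset ℕ} {f : HPoly F H}
    (hf : IsMultilinearMonomial F s f) (φ : ∀ i, ℕ → I i) :
    evalAt ρ (fun j => ∑ i, (φ i j : L)) f = ∑ i, evalAt ρ (fun j => φ i j) f := by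
  induction hf with
  | hvar j h => simp only [evalAt_hvar, map_sum]
  | lie _ _ _ ihf ihg =>
    simp only [LieHom.map_lie, ihf, ihg, sum_lie, lie_sum]
    refine sum_congr rfl fun i _ => sum_eq_single i (fun k _ hki => ?_) (by simp)
    rw [evalAt_coe (I k) (hinv k), evalAt_coe (I i) (hinv i)]
    exact lie_eq_zero_of_disjoint (hdisj hki) (Subtype.property _) (Subtype.property _)

theorem evalAt_sum_of_mem_multilinearPart (hdisj : Pairwise (Disjoint on I))
    (hinv : ∀ i, IsHInvariant ρ (I i)) {n : ℕ} {f : HPoly F H} (hf : f ∈ multilinearPart F H n)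
    (φ : ∀ i, ℕ → I i) :
    evalAt ρ (fun j => ∑ i, (φ i j : L)) f = ∑ i, evalAt ρ (fun j => φ i j) f := by
  induction hf using Submodule.span_induction with
  | mem f hf => exact IsMultilinearMonomial.evalAt_sum hdisj hinv hf φ
  | zero => simp only [map_zero, sum_const_zero]
  | add f g _ _ hf hg => simp only [map_add, hf, hg, sum_add_distrib]
  | smul c f _ hf => simp only [map_smul, hf, smul_sum]

theorem hCodim_le_sum [FiniteDimensional F L] (hdisj : Pairwise (Disjoint on I))
    (htop : ⨆ i, (I i).toSubmodule = ⊤) (hinv : ∀ i, IsHInvariant ρ (I i)) (n : ℕ) :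
    hCodim ρ n ≤ ∑ i, hCodim (restrictAction ρ (I i) (hinv i)) n := by
  refine finrank_map_mkQ_le_sum (fun i => hIdentities_le_restrictAction (I i) (hinv i)) ?_
  rintro f ⟨hf, hId⟩
  refine mem_hIdentities.2 fun ψ => ?_
  have decompose (a : L) : ∃ b : ∀ i, I i, ∑ i, (b i : L) = a := by
    have := Submodule.mem_iSup_finset_iff_exists_sum (s := univ) (fun i => (I i).toSubmodule) a
    exact this.1 (by simp [htop])
  choose b hb using decompose
  have hψ : ψ = fun j => ∑ i, (b (ψ j) i : L) := funext fun j => (hb (ψ j)).symm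
  rw [hψ, evalAt_sum_of_mem_multilinearPart hdisj hinv hf fun i j => b (ψ j) i]
  refine sum_eq_zero fun i _ => ?_
  rw [evalAt_coe (I i) (hinv i), mem_hIdentities.1 ((Submodule.mem_iInf _).1 hId i)]
  rfl

theorem hasExponentialGrowth_hCodim_of_isInternal [FiniteDimensional F L]
    [LieAlgebra.IsKilling F L] [DecidableEq ι] (hρ : IsGeneralizedAction ρ)
    (hsum : DirectSum.IsInternal fun i => (I i).toSubmodule) (hinv : ∀ i, IsHInvariant ρ (I i))
    (hsimple : ∀ i, IsHSimple (restrictAction ρ (I i) (hinv i))) :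
    HasExponentialGrowth (hCodim ρ)
      (univ.sup fun i => finrank (Centroid (restrictAction ρ (I i) (hinv i))) (I i)) := by
  have hdisj : Pairwise (Disjoint on I) := fun i j hij =>
    LieSubmodule.disjoint_toSubmodule.1 (hsum.submodule_iSupIndep.pairwiseDisjoint hij)
  refine .of_le_sum (fun i => ?_) (fun i => hCodim_restrictAction_le (I i) (hinv i))
    (hCodim_le_sum hdisj hsum.submodule_iSup_eq_top hinv)
  have := isKilling_lieIdeal (I i)
  exact (hsimple i).hasExponentialGrowth (hρ.restrictAction (I i) (hinv i))

end InvariantIdeals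

end HLie

open HLie in
theorem mainTheorem3_general {F L H ι : Type*} [Field F] [LieRing L] [LieAlgebra F L]
    [FiniteDimensional F L] [LieAlgebra.IsKilling F L] [Ring H] [Algebra F H]
    [Fintype ι] [DecidableEq ι] (ρ : H →ₐ[F] Module.End F L) (hρ : IsGeneralizedAction ρ)
    (I : ι → LieIdeal F L) (hsum : DirectSum.IsInternal fun i => (I i).toSubmodule)
    (hinv : ∀ i, IsHInvariant ρ (I i))
    (hsimple : ∀ i, IsHSimple (restrictAction ρ (I i) (hinv i))) :
    HasHExponent ρ (Finset.univ.sup fun i =>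
      Module.finrank (Centroid (restrictAction ρ (I i) (hinv i))) (I i) : ℕ) ∧
    (IsAlgClosed F → HasHExponent ρ (Finset.univ.sup fun i => Module.finrank F (I i) : ℕ)) ∧
    ((∀ i, IsHCentral (restrictAction ρ (I i) (hinv i))) →
      HasHExponent ρ (Finset.univ.sup fun i => Module.finrank F (I i) : ℕ)) := by
  have exponent :=
    (hasExponentialGrowth_hCodim_of_isInternal hρ hsum hinv hsimple).tendsto_rpow_one_div
  have central (hcentral : ∀ i, IsHCentral (restrictAction ρ (I i) (hinv i))) :
      HasHExponent ρ (Finset.univ.sup fun i => Module.finrank F (I i) : ℕ) := by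
    simpa only [fun i => (hsimple i).finrank_centroid (hcentral i)] using! exponent
  exact ⟨exponent, fun _ => central fun i => (hsimple i).isHCentral, central⟩

theorem mainTheorem3 {F L H : Type*} [Field F] [CharZero F]
    [LieRing L] [LieAlgebra F L] [FiniteDimensional F L] [LieAlgebra.HasTrivialRadical F L]
    [Ring H] [Algebra F H]
    (ρ : H →ₐ[F] Module.End F L) (hρ : HLie.IsGeneralizedAction ρ)
    {m : ℕ} (I : Fin m → LieIdeal F L)
    (hsum : DirectSum.IsInternal fun i => (I i).toSubmodule)
    (hinv : ∀ i, HLie.IsHInvariant ρ (I i))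
    (hsimple : ∀ i, HLie.IsHSimple (HLie.restrictAction ρ (I i) (hinv i))) :
    (∃ d : ℕ, HLie.HasHExponent ρ d) ∧
    (IsAlgClosed F →
      HLie.HasHExponent ρ (Finset.univ.sup fun i => Module.finrank F (I i) : ℕ)) ∧
    ((∀ i, HLie.IsHCentral (HLie.restrictAction ρ (I i) (hinv i))) →
      HLie.HasHExponent ρ (Finset.univ.sup fun i => Module.finrank F (I i) : ℕ)) := by
  obtain ⟨exponent, formula⟩ := mainTheorem3_general ρ hρ I hsum hinv hsimple
  exact ⟨⟨_, exponent⟩, formula⟩
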